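/- Let $K$ be a field with an embedding $K\hookrightarrow\mathbb{C}$ (for instance $K=\mathbb{R}$ or $K=\mathbb{C}$). **Rooted trees.** Let $H_R=K[\mathcal{T}]$ be the free commutative $K$-algebra on the set $\mathcal{T}$ of isomorphism classes of finite non-empty (unordered) rooted trees. Its monomials are the rooted forests, and $B_+\colon H_R\to H_R$ is the linear map that sends a forest to the tree obtained by connecting all its roots to a new root. $H_R$ is a Hopf algebra: its coproduct is the algebra morphism with $\Delta\circ B_+=B_+\otimes 1+(\mathrm{id}\otimes B_+)\circ\Delta$, its counit $\varepsilon$ vanishes on all non-empty forests, and $S$ is its antipode. $K[x]$ is the Hopf algebra with $\Delta(x)=x\otimes 1+1\otimes x$, $\varepsilon(x)=0$, $S(x)=-x$. **Toy model.** Let $f\colon(0,\infty)\to\mathbb{C}$ be a kernel such that $\zeta\mapsto f(\zeta)\zeta^{-\sigma}$ is integrable on $(0,\infty)$ for all sufficiently small $\sigma>0$, and such that $F(z)=\int_0^\infty f(\zeta)\,\zeta^{-z}\,d\zeta$ is given, for $z$ near $0$ with $\operatorname{Re}z>0$, by a convergent Laurent series $\sum_{n\ge-1}c_nz^n$ with all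 $c_n\in K$. The regularized Feynman rules are the algebra morphism $\phi$ from $H_R$ to functions of $z$ and of the scale $s>0$ with $$\phi_s(B_+(x))=\int_0^\infty f(\zeta)\,(s\zeta)^{-z}\,\phi_{s\zeta}(x)\,d\zeta\qquad\text{for all forests }x.$$ For $\mu>0$, the momentum scheme at the subtraction point $\mu$ (evaluation at $s=\mu$) gives the counterterm $Z=\phi_\mu\circ S$ and the renormalized Feynman rules $\phi_{R,s}=Z\star\phi_s$, where $\star$ is the convolution product $\alpha\star\beta=m\circ(\alpha\otimes\beta)\circ\Delta$. **Statement.** For every such $K$ and $f$: 1. For each $x\in H_R$, the integral $\int_0^\infty f(\zeta)(s\zeta)^{-z}\phi_{s\zeta}(x)\,d\zeta$ converges absolutely for all $s>0$ and all $z$ sufficiently close to $0$ with $\operatorname{Re}z>0$. 2. For all $x\in H_R$ and $s,\mu>0$, the function $z\mapsto\phi_{R,s}(x)$ continues meromorphically from $\operatorname{Re}z>0$ to a neighbourhood of $z=0$, and its limit at $z\to0$ (the physical limit) exists. There is a unique map $\phi_{\mathrm{phys}}\colon H_R\to K[x]$, the same for all $\mu$, such that this limit is always the value of the polynomial $\phi_{\mathrm{phys}}(x)$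 at $\ln\frac{s}{\mu}$. 3. This physical limit $\phi_{\mathrm{phys}}\colon H_R\to K[x]$ is a morphism of Hopf algebras: it is a morphism of unital algebras and of counital coalgebras, and it commutes with the antipodes. Moreover, the kernel $f(\zeta)=\frac{1}{1+\zeta}$ of the original toy model satisfies the assumptions above, with $K=\mathbb{R}$. -/

import Mathlib

open scoped TensorProduct Polynomial Topology

noncomputable section

namespace ToyModel

/-! ## Rooted trees -/

/-- Finite rooted trees with an enumeration of the children of every node. -/
inductive PlanarTree : Type
  | node (n : ℕ) (c : Fin n → PlanarTree) : PlanarTree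

namespace PlanarTree

/-- Isomorphism of rooted trees: a bijection between the children of the two roots such that
corresponding children carry isomorphic subtrees. -/
def Iso : PlanarTree → PlanarTree → Prop
  | node n c, node m d => ∃ e : Fin n ≃ Fin m, ∀ i, Iso (c i) (d (e i))

theorem Iso.refl : ∀ t : PlanarTree, Iso t t
  | node _ c => ⟨Equiv.refl _, fun i => Iso.refl (c i)⟩

theorem Iso.symm : ∀ {t u : PlanarTree}, Iso t u → Iso u t
  | node _ _, node _ d, ⟨e, h⟩ =>
    ⟨e.symm, fun i => by
      have h1 := (h (e.symm i)).symm
      rwa [e.apply_symm_apply] at h1⟩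

theorem Iso.trans : ∀ {t u v : PlanarTree}, Iso t u → Iso u v → Iso t v
  | node _ _, node _ _, node _ _, ⟨e, h⟩, ⟨e', h'⟩ =>
    ⟨e.trans e', fun i => (h i).trans (h' (e i))⟩

instance isoSetoid : Setoid PlanarTree := ⟨Iso, Iso.refl, Iso.symm, Iso.trans⟩

/-- Bottom-up recursion. -/
def fold {A : Type*} (g : Multiset A → A) : PlanarTree → A
  | node _ c => g (Finset.univ.val.map fun i => fold g (c i))

theorem fold_iso {A : Type*} (g : Multiset A → A) :
    ∀ {t u : PlanarTree}, Iso t u → fold g t = fold g u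
  | node n c, node m d, ⟨e, h⟩ => by
    have h1 : (fun i => fold g (c i)) = (fun j => fold g (d j)) ∘ e :=
      funext fun i => fold_iso g (h i)
    simp only [fold]
    rw [h1, ← Multiset.map_map]
    congr 2
    have h2 := congrArg Finset.val (Finset.map_univ_equiv e)
    rwa [Finset.map_val] at h2

end PlanarTree

/-- Rooted trees: isomorphism classes, so that the children of a node are unordered. -/
def RootedTree : Type := Quotient PlanarTree.isoSetoid

open Classical in
theorem exists_equiv_of_map_eq {α β γ : Type*} [Fintype α] [Fintype β] (f : α → γ) (g : β → γ)
    (h : Finset.univ.val.map f = Finset.univ.val.map g) : ∃ e : α ≃ β, ∀ i, f i = g (e i) := by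
  have key : ∀ c : γ, Fintype.card {i // f i = c} = Fintype.card {j // g j = c} := by
    intro c
    have h1 := congrArg (Multiset.count c) h
    rw [Multiset.count_map, Multiset.count_map] at h1
    rw [Fintype.card_subtype, Fintype.card_subtype]
    simpa [Finset.card, eq_comm] using h1
  let e : α ≃ β := (Equiv.sigmaFiberEquiv f).symm.trans
    ((Equiv.sigmaCongrRight fun c => Fintype.equivOfCardEq (key c)).trans
      (Equiv.sigmaFiberEquiv g))
  exact ⟨e, fun i => ((Fintype.equivOfCardEq (key (f i))) ⟨i, rfl⟩).2.symm⟩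

theorem map_toList_get {γ : Type*} (s : Multiset γ) :
    (Finset.univ : Finset (Fin s.toList.length)).val.map s.toList.get = s := by
  have h : (Finset.univ : Finset (Fin s.toList.length)).val =
      (List.finRange s.toList.length : Multiset (Fin s.toList.length)) := rfl
  rw [h, Multiset.map_coe, ← List.ofFn_eq_map, List.ofFn_get, Multiset.coe_toList]

namespace RootedTree

/-- The grafting of a forest (a multiset of rooted trees): all its roots become the children of
a new root. The auxiliary choices do not matter, see `graft_mk`. -/
def graft (s : Multiset RootedTree) : RootedTree :=
  Quotient.mk _ (PlanarTree.node s.toList.length fun i => (s.toList.get i).out)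

theorem graft_mk {n : ℕ} (c : Fin n → PlanarTree) :
    graft (Finset.univ.val.map fun i => (Quotient.mk _ (c i) : RootedTree)) =
      Quotient.mk _ (PlanarTree.node n c) := by
  obtain ⟨e, he⟩ := exists_equiv_of_map_eq _ _
    (map_toList_get (Finset.univ.val.map fun i => (Quotient.mk _ (c i) : RootedTree)))
  exact Quotient.sound ⟨e, fun i => Quotient.exact ((Quotient.out_eq _).trans (he i))⟩

/-- Bottom-up recursion on rooted trees; see `fold_graft`. -/
def fold {A : Type*} (g : Multiset A → A) (t : RootedTree) : A :=
  Quotient.liftOn t (PlanarTree.fold g) fun _ _ h => PlanarTree.fold_iso g h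

theorem fold_graft {A : Type*} (g : Multiset A → A) (s : Multiset RootedTree) :
    fold g (graft s) = g (s.map (fold g)) := by
  have h : ∀ t : RootedTree, PlanarTree.fold g t.out = fold g t := fun t => by
    conv_rhs => rw [← Quotient.out_eq t]
    rfl
  have h1 : fold g (graft s) =
      g ((Finset.univ : Finset (Fin s.toList.length)).val.map
        fun i => PlanarTree.fold g (s.toList.get i).out) := rfl
  rw [h1]
  simp only [h]
  conv_rhs => rw [← map_toList_get s, Multiset.map_map]
  rfl

theorem graft_induction {P : RootedTree → Prop}
    (h : ∀ s : Multiset RootedTree, (∀ t ∈ s, P t) → P (graft s)) (t : RootedTree) : P t := by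
  induction t using Quotient.ind with
  | _ p =>
    induction p with
    | node n c ih =>
      rw [← graft_mk]
      refine h _ fun t ht => ?_
      obtain ⟨i, -, rfl⟩ := Multiset.mem_map.1 ht
      exact ih i

end RootedTree

/-! ## The algebra of rooted trees, grafting and the universal property -/

/-- The free commutative algebra on the rooted trees; its monomials are the forests. -/
def HR (K : Type*) [CommRing K] : Type _ := MvPolynomial RootedTree K

section HR

variable (K : Type*) [CommRing K]

instance : CommRing (HR K) := inferInstanceAs (CommRing (MvPolynomial RootedTree K))
instance : Algebra K (HR K) := inferInstanceAs (Algebra K (MvPolynomial RootedTree K))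

/-- A rooted tree as an element of `HR K`. -/
def tree (t : RootedTree) : HR K := (MvPolynomial.X t : MvPolynomial RootedTree K)

/-- A forest as an element of `HR K`: the product of its trees. -/
def forest (s : Multiset RootedTree) : HR K := (s.map (tree K)).prod

/-- The basis of `HR K` consisting of the forests. -/
def forestBasis : Module.Basis (Multiset RootedTree) K (HR K) :=
  letI := Classical.decEq RootedTree
  (show Module.Basis (RootedTree →₀ ℕ) K (HR K) from
    MvPolynomial.basisMonomials RootedTree K).reindex Multiset.toFinsupp.symm.toEquiv

theorem forestBasis_apply (s : Multiset RootedTree) : forestBasis K s = forest K s := by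
  let := Classical.decEq RootedTree
  rw [forestBasis, Module.Basis.reindex_apply]
  change MvPolynomial.basisMonomials RootedTree K (Multiset.toFinsupp s) = _
  rw [MvPolynomial.coe_basisMonomials]
  change MvPolynomial.monomial (Multiset.toFinsupp s) (1 : K) = _
  rw [forest]
  induction s using Multiset.induction_on with
  | empty => simp; rfl
  | cons t s ih =>
    rw [Multiset.map_cons, Multiset.prod_cons, ← ih, ← Multiset.singleton_add, map_add,
      Multiset.toFinsupp_singleton]
    have h : MvPolynomial.monomial (Finsupp.single t 1 + Multiset.toFinsupp s) (1 : K) =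
        MvPolynomial.X t * MvPolynomial.monomial (Multiset.toFinsupp s) (1 : K) := by
      rw [MvPolynomial.X, MvPolynomial.monomial_mul, one_mul]
    exact h

/-- The grafting operator `B₊`. -/
def bPlus : HR K →ₗ[K] HR K :=
  (forestBasis K).constr K fun s => tree K (RootedTree.graft s)

theorem bPlus_forest (s : Multiset RootedTree) :
    bPlus K (forest K s) = tree K (RootedTree.graft s) := by
  rw [bPlus, ← forestBasis_apply, Module.Basis.constr_basis]

variable {K}

theorem algHom_ext_tree {A : Type*} [Semiring A] [Algebra K A] {f g : HR K →ₐ[K] A}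
    (h : ∀ t, f (tree K t) = g (tree K t)) : f = g :=
  MvPolynomial.algHom_ext h

theorem algHom_forest {A : Type*} [CommSemiring A] [Algebra K A] (f : HR K →ₐ[K] A)
    (s : Multiset RootedTree) : f (forest K s) = (s.map fun t => f (tree K t)).prod := by
  rw [forest, map_multiset_prod, Multiset.map_map]
  rfl

theorem linearMap_ext_forest {M : Type*} [AddCommMonoid M] [Module K M] {f g : HR K →ₗ[K] M}
    (h : ∀ s, f (forest K s) = g (forest K s)) : f = g :=
  (forestBasis K).ext fun s => by rw [forestBasis_apply, h]

theorem algHom_ext_bPlus {A : Type*} [CommSemiring A] [Algebra K A] {f g : HR K →ₐ[K] A}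
    (h : ∀ s, f (forest K s) = g (forest K s) →
      f (bPlus K (forest K s)) = g (bPlus K (forest K s))) : f = g := by
  refine algHom_ext_tree fun t => ?_
  induction t using RootedTree.graft_induction with
  | h s ih =>
    rw [← bPlus_forest]
    refine h s ?_
    rw [algHom_forest, algHom_forest]
    exact congrArg _ (Multiset.map_congr rfl ih)

variable (K)

/-- The algebra morphism `ρ` with `ρ (B₊ f) = L (ρ f)` for all forests `f`. -/
def universalHom {A : Type*} [CommSemiring A] [Algebra K A] (L : A → A) : HR K →ₐ[K] A :=
  (MvPolynomial.aeval (RootedTree.fold fun m => L m.prod) : MvPolynomial RootedTree K →ₐ[K] A)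

theorem universalHom_tree {A : Type*} [CommSemiring A] [Algebra K A] (L : A → A)
    (t : RootedTree) :
    universalHom K L (tree K t) = RootedTree.fold (fun m => L m.prod) t :=
  MvPolynomial.aeval_X _ t

theorem universalHom_bPlus_forest {A : Type*} [CommSemiring A] [Algebra K A] (L : A → A)
    (s : Multiset RootedTree) :
    universalHom K L (bPlus K (forest K s)) = L (universalHom K L (forest K s)) := by
  rw [bPlus_forest, universalHom_tree, RootedTree.fold_graft, algHom_forest]
  simp only [universalHom_tree]

theorem universalHom_bPlus {A : Type*} [CommSemiring A] [Algebra K A] (L : A →ₗ[K] A)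
    (x : HR K) : universalHom K L (bPlus K x) = L (universalHom K L x) := by
  have h : (universalHom K L).toLinearMap ∘ₗ bPlus K = L ∘ₗ (universalHom K L).toLinearMap :=
    linearMap_ext_forest fun s => universalHom_bPlus_forest K L s
  exact LinearMap.congr_fun h x

/-! ## The Hopf algebra structure of `HR K` -/

/-- The counit: `1` on the empty forest and `0` on all other forests. -/
def counitHR : HR K →ₐ[K] K := universalHom K (0 : K →ₗ[K] K)

theorem counitHR_bPlus (x : HR K) : counitHR K (bPlus K x) = 0 :=
  universalHom_bPlus K 0 x

/-- The operator on `HR K ⊗ HR K` that induces the coproduct; see `comulHR_bPlus`. -/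
def comulOp : HR K ⊗[K] HR K →ₗ[K] HR K ⊗[K] HR K :=
  (TensorProduct.mk K (HR K) (HR K)).flip 1 ∘ₗ bPlus K ∘ₗ
      (TensorProduct.rid K (HR K)).toLinearMap ∘ₗ (counitHR K).toLinearMap.lTensor (HR K)
    + (bPlus K).lTensor (HR K)

/-- The coproduct, determined by `comulHR_bPlus` as a morphism of algebras. -/
def comulHR : HR K →ₐ[K] HR K ⊗[K] HR K := universalHom K (comulOp K)

theorem rid_counit_comulHR (x : HR K) :
    TensorProduct.rid K (HR K) ((counitHR K).toLinearMap.lTensor (HR K) (comulHR K x)) = x := by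
  have h : ((Algebra.TensorProduct.rid K K (HR K)).toAlgHom.comp
      (Algebra.TensorProduct.map (AlgHom.id K (HR K)) (counitHR K))).comp (comulHR K) =
      AlgHom.id K (HR K) := by
    refine algHom_ext_bPlus fun s ih => ?_
    change TensorProduct.rid K (HR K)
      ((counitHR K).toLinearMap.lTensor (HR K) (comulHR K (forest K s))) = forest K s at ih
    change TensorProduct.rid K (HR K) ((counitHR K).toLinearMap.lTensor (HR K)
      (comulHR K (bPlus K (forest K s)))) = bPlus K (forest K s)
    have h1 : comulHR K (bPlus K (forest K s)) = comulOp K (comulHR K (forest K s)) :=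
      universalHom_bPlus K (comulOp K) _
    have h2 : (counitHR K).toLinearMap ∘ₗ bPlus K = 0 :=
      LinearMap.ext fun x => counitHR_bPlus K x
    rw [h1]
    simp only [comulOp, LinearMap.add_apply, LinearMap.comp_apply, LinearEquiv.coe_coe, ih,
      map_add, ← LinearMap.lTensor_comp_apply, h2, LinearMap.lTensor_zero, LinearMap.zero_apply,
      add_zero]
    simp
  exact DFunLike.congr_fun h x

theorem comulHR_bPlus (x : HR K) :
    comulHR K (bPlus K x) =
      bPlus K x ⊗ₜ[K] 1 + (bPlus K).lTensor (HR K) (comulHR K x) := by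
  have h := universalHom_bPlus K (comulOp K) x
  change comulHR K (bPlus K x) = comulOp K (comulHR K x) at h
  rw [h]
  simp only [comulOp, LinearMap.add_apply, LinearMap.comp_apply, LinearEquiv.coe_coe,
    rid_counit_comulHR]
  rfl

theorem assoc_comul_lTensor_bPlus (y : HR K ⊗[K] HR K) :
    TensorProduct.assoc K _ _ _
        ((comulHR K).toLinearMap.rTensor (HR K) ((bPlus K).lTensor (HR K) y)) =
      ((bPlus K).lTensor (HR K)).lTensor (HR K)
        (TensorProduct.assoc K _ _ _ ((comulHR K).toLinearMap.rTensor (HR K) y)) := by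
  induction y using TensorProduct.induction_on with
  | zero => simp
  | add a b ha hb => simp only [map_add, ha, hb]
  | tmul a b =>
    simp only [LinearMap.lTensor_tmul, LinearMap.rTensor_tmul]
    generalize (comulHR K).toLinearMap a = c
    induction c using TensorProduct.induction_on with
    | zero => simp
    | add c d hc hd => simp only [TensorProduct.add_tmul, map_add, hc, hd]
    | tmul c d => simp

theorem lTensor_comul_lTensor_bPlus (y : HR K ⊗[K] HR K) :
    (comulHR K).toLinearMap.lTensor (HR K) ((bPlus K).lTensor (HR K) y) =
      TensorProduct.assoc K _ _ _ ((bPlus K).lTensor (HR K) y ⊗ₜ[K] (1 : HR K)) +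
      ((bPlus K).lTensor (HR K)).lTensor (HR K)
        ((comulHR K).toLinearMap.lTensor (HR K) y) := by
  induction y using TensorProduct.induction_on with
  | zero => simp
  | add a b ha hb =>
    simp only [map_add, ha, hb, TensorProduct.add_tmul]
    abel
  | tmul a b =>
    simp only [LinearMap.lTensor_tmul, AlgHom.toLinearMap_apply, comulHR_bPlus,
      TensorProduct.tmul_add, TensorProduct.assoc_tmul]

instance : Bialgebra K (HR K) :=
  .ofAlgHom (comulHR K) (counitHR K)
    (by
      refine algHom_ext_bPlus fun s ih => ?_
      change TensorProduct.assoc K _ _ _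
        ((comulHR K).toLinearMap.rTensor (HR K) (comulHR K (forest K s))) =
        (comulHR K).toLinearMap.lTensor (HR K) (comulHR K (forest K s)) at ih
      change TensorProduct.assoc K _ _ _
        ((comulHR K).toLinearMap.rTensor (HR K) (comulHR K (bPlus K (forest K s)))) =
        (comulHR K).toLinearMap.lTensor (HR K) (comulHR K (bPlus K (forest K s)))
      rw [comulHR_bPlus, map_add, map_add, map_add, assoc_comul_lTensor_bPlus, ih,
        lTensor_comul_lTensor_bPlus, LinearMap.rTensor_tmul, LinearMap.lTensor_tmul,
        AlgHom.toLinearMap_apply, AlgHom.toLinearMap_apply, comulHR_bPlus, map_one,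
        TensorProduct.add_tmul, map_add, Algebra.TensorProduct.one_def,
        TensorProduct.assoc_tmul, add_assoc])
    (by
      refine algHom_ext_bPlus fun s ih => ?_
      change (counitHR K).toLinearMap.rTensor (HR K) (comulHR K (forest K s)) =
        1 ⊗ₜ[K] forest K s at ih
      change (counitHR K).toLinearMap.rTensor (HR K) (comulHR K (bPlus K (forest K s))) =
        1 ⊗ₜ[K] bPlus K (forest K s)
      have h (y : HR K ⊗[K] HR K) :
          (counitHR K).toLinearMap.rTensor (HR K) ((bPlus K).lTensor (HR K) y) =
          (bPlus K).lTensor K ((counitHR K).toLinearMap.rTensor (HR K) y) := by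
        rw [← LinearMap.comp_apply, ← LinearMap.comp_apply, LinearMap.rTensor_comp_lTensor,
          LinearMap.lTensor_comp_rTensor]
      rw [comulHR_bPlus, map_add, h, ih, LinearMap.rTensor_tmul, AlgHom.toLinearMap_apply,
        counitHR_bPlus, TensorProduct.zero_tmul, zero_add, LinearMap.lTensor_tmul])
    (by
      refine AlgHom.ext fun x => ?_
      refine (TensorProduct.rid K (HR K)).injective ?_
      change TensorProduct.rid K (HR K)
        ((counitHR K).toLinearMap.lTensor (HR K) (comulHR K x)) =
        TensorProduct.rid K (HR K) (x ⊗ₜ[K] (1 : K))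
      rw [rid_counit_comulHR, TensorProduct.rid_tmul, one_smul])

/-- The operator on `HR K ⊗ HR K` whose induced morphism is `(S ⊗ id) ∘ Δ` with the
antipode `S`. -/
def antipodeOp : HR K ⊗[K] HR K →ₗ[K] HR K ⊗[K] HR K :=
  (bPlus K).lTensor (HR K) -
    (TensorProduct.mk K (HR K) (HR K)).flip 1 ∘ₗ LinearMap.mul' K (HR K) ∘ₗ
      (bPlus K).lTensor (HR K)

/-- The antipode; it is characterized by the instance `HopfAlgebra K (HR K)` below. -/
def antipodeHR : HR K →ₐ[K] HR K :=
  ((Algebra.TensorProduct.rid K K (HR K)).toAlgHom.comp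
    (Algebra.TensorProduct.map (AlgHom.id K (HR K)) (counitHR K))).comp
      (universalHom K (antipodeOp K))

theorem antipodeHR_bPlus (x : HR K) :
    antipodeHR K (bPlus K x) =
      -LinearMap.mul' K (HR K)
        ((bPlus K).lTensor (HR K) (universalHom K (antipodeOp K) x)) := by
  have h2 : (counitHR K).toLinearMap ∘ₗ bPlus K = 0 :=
    LinearMap.ext fun x => counitHR_bPlus K x
  change TensorProduct.rid K (HR K) ((counitHR K).toLinearMap.lTensor (HR K)
    (universalHom K (antipodeOp K) (bPlus K x))) = _
  rw [universalHom_bPlus]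
  simp only [antipodeOp, LinearMap.sub_apply, LinearMap.comp_apply, map_sub,
    ← LinearMap.lTensor_comp_apply, h2, LinearMap.lTensor_zero, LinearMap.zero_apply,
    zero_sub]
  simp

theorem rTensor_antipodeHR_comul (x : HR K) :
    (antipodeHR K).toLinearMap.rTensor (HR K) (comulHR K x) =
      universalHom K (antipodeOp K) x := by
  have h : (Algebra.TensorProduct.map (antipodeHR K) (AlgHom.id K (HR K))).comp (comulHR K) =
      universalHom K (antipodeOp K) := by
    refine algHom_ext_bPlus fun s ih => ?_
    change (antipodeHR K).toLinearMap.rTensor (HR K) (comulHR K (forest K s)) = _ at ih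
    change (antipodeHR K).toLinearMap.rTensor (HR K) (comulHR K (bPlus K (forest K s))) = _
    have h1 (y : HR K ⊗[K] HR K) :
        (antipodeHR K).toLinearMap.rTensor (HR K) ((bPlus K).lTensor (HR K) y) =
        (bPlus K).lTensor (HR K) ((antipodeHR K).toLinearMap.rTensor (HR K) y) := by
      rw [← LinearMap.comp_apply, ← LinearMap.comp_apply, LinearMap.rTensor_comp_lTensor,
        LinearMap.lTensor_comp_rTensor]
    rw [comulHR_bPlus, map_add, h1, ih, LinearMap.rTensor_tmul, AlgHom.toLinearMap_apply,
      antipodeHR_bPlus, universalHom_bPlus]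
    simp only [antipodeOp, LinearMap.sub_apply, LinearMap.comp_apply, LinearMap.flip_apply,
      TensorProduct.mk_apply, TensorProduct.neg_tmul]
    abel
  exact DFunLike.congr_fun h x

theorem mul_antipodeOp (x : HR K) :
    LinearMap.mul' K (HR K) (universalHom K (antipodeOp K) x) =
      algebraMap K (HR K) (counitHR K x) := by
  have h : (Algebra.TensorProduct.lmul' K (S := HR K)).comp (universalHom K (antipodeOp K)) =
      (Algebra.ofId K (HR K)).comp (counitHR K) := by
    refine algHom_ext_bPlus fun s _ => ?_
    change LinearMap.mul' K (HR K) (universalHom K (antipodeOp K) (bPlus K (forest K s))) =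
      algebraMap K (HR K) (counitHR K (bPlus K (forest K s)))
    rw [universalHom_bPlus, counitHR_bPlus, map_zero]
    simp [antipodeOp]
  exact DFunLike.congr_fun h x

/-- The convolution product `id ⋆ S`. -/
def idConvAntipode : HR K →ₐ[K] HR K :=
  (Algebra.TensorProduct.lift (AlgHom.id K (HR K)) (antipodeHR K)
    fun _ _ => Commute.all _ _).comp (comulHR K)

theorem lift_lTensor_bPlus (y : HR K ⊗[K] HR K) :
    Algebra.TensorProduct.lift (AlgHom.id K (HR K)) (antipodeHR K) (fun _ _ => Commute.all _ _)
        ((bPlus K).lTensor (HR K) y) =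
      -LinearMap.mul' K (HR K) ((LinearMap.mul' K (HR K) ∘ₗ
        TensorProduct.map (antipodeHR K).toLinearMap (bPlus K)).lTensor (HR K)
        ((comulHR K).toLinearMap.lTensor (HR K) y)) := by
  induction y using TensorProduct.induction_on with
  | zero => simp
  | add a b ha hb =>
    simp only [map_add, ha, hb]
    abel
  | tmul a b =>
    have h : TensorProduct.map (antipodeHR K).toLinearMap (bPlus K) (comulHR K b) =
        (bPlus K).lTensor (HR K) (universalHom K (antipodeOp K) b) := by
      rw [← rTensor_antipodeHR_comul, ← LinearMap.comp_apply, LinearMap.lTensor_comp_rTensor]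
    simp only [LinearMap.lTensor_tmul, Algebra.TensorProduct.lift_tmul, AlgHom.id_apply,
      antipodeHR_bPlus, LinearMap.comp_apply, AlgHom.toLinearMap_apply, h,
      LinearMap.mul'_apply, mul_neg]

theorem mul_lTensor_assoc (y : HR K ⊗[K] HR K) :
    LinearMap.mul' K (HR K) ((LinearMap.mul' K (HR K) ∘ₗ
        TensorProduct.map (antipodeHR K).toLinearMap (bPlus K)).lTensor (HR K)
        (TensorProduct.assoc K _ _ _ ((comulHR K).toLinearMap.rTensor (HR K) y))) =
      LinearMap.mul' K (HR K) ((bPlus K).lTensor (HR K)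
        ((idConvAntipode K).toLinearMap.rTensor (HR K) y)) := by
  induction y using TensorProduct.induction_on with
  | zero => simp
  | add a b ha hb => simp only [map_add, ha, hb]
  | tmul a b =>
    simp only [LinearMap.rTensor_tmul, AlgHom.toLinearMap_apply, LinearMap.lTensor_tmul,
      idConvAntipode, AlgHom.comp_apply, LinearMap.mul'_apply]
    generalize comulHR K a = c
    induction c using TensorProduct.induction_on with
    | zero => simp
    | add c d hc hd => simp only [TensorProduct.add_tmul, map_add, hc, hd, add_mul]
    | tmul c d => simp [mul_assoc]

theorem idConvAntipode_apply (x : HR K) :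
    idConvAntipode K x = algebraMap K (HR K) (counitHR K x) := by
  have h : (Algebra.TensorProduct.map (idConvAntipode K) (AlgHom.id K (HR K))).comp
      (comulHR K) = Algebra.TensorProduct.includeRight := by
    refine algHom_ext_bPlus fun s ih => ?_
    change (idConvAntipode K).toLinearMap.rTensor (HR K) (comulHR K (forest K s)) =
      1 ⊗ₜ[K] forest K s at ih
    change (idConvAntipode K).toLinearMap.rTensor (HR K) (comulHR K (bPlus K (forest K s))) =
      1 ⊗ₜ[K] bPlus K (forest K s)
    have h1 (y : HR K ⊗[K] HR K) :
        (idConvAntipode K).toLinearMap.rTensor (HR K) ((bPlus K).lTensor (HR K) y) =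
        (bPlus K).lTensor (HR K) ((idConvAntipode K).toLinearMap.rTensor (HR K) y) := by
      rw [← LinearMap.comp_apply, ← LinearMap.comp_apply, LinearMap.rTensor_comp_lTensor,
        LinearMap.lTensor_comp_rTensor]
    have h2 : (comulHR K).toLinearMap.lTensor (HR K) (comulHR K (forest K s)) =
        TensorProduct.assoc K _ _ _
          ((comulHR K).toLinearMap.rTensor (HR K) (comulHR K (forest K s))) :=
      (Coalgebra.coassoc_apply (R := K) (forest K s)).symm
    have h3 : idConvAntipode K (bPlus K (forest K s)) = 0 := by
      rw [idConvAntipode, AlgHom.comp_apply, comulHR_bPlus, map_add, lift_lTensor_bPlus, h2,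
        mul_lTensor_assoc, ih]
      simp
    rw [comulHR_bPlus, map_add, h1, ih, LinearMap.rTensor_tmul, AlgHom.toLinearMap_apply, h3,
      TensorProduct.zero_tmul, zero_add, LinearMap.lTensor_tmul]
  have h1 : (idConvAntipode K).toLinearMap.rTensor (HR K) (comulHR K x) = 1 ⊗ₜ[K] x :=
    DFunLike.congr_fun h x
  have h2 (y : HR K ⊗[K] HR K) :
      TensorProduct.rid K (HR K) ((counitHR K).toLinearMap.lTensor (HR K)
        ((idConvAntipode K).toLinearMap.rTensor (HR K) y)) =
      idConvAntipode K (TensorProduct.rid K (HR K)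
        ((counitHR K).toLinearMap.lTensor (HR K) y)) := by
    induction y using TensorProduct.induction_on with
    | zero => simp
    | add a b ha hb => simp only [map_add, ha, hb]
    | tmul a b => simp
  rw [← rid_counit_comulHR K x, ← h2, h1, rid_counit_comulHR, LinearMap.lTensor_tmul,
    TensorProduct.rid_tmul, Algebra.algebraMap_eq_smul_one]
  rfl

instance : HopfAlgebra K (HR K) :=
  .ofAlgHom (antipodeHR K)
    (by
      refine AlgHom.ext fun x => ?_
      have h (y : HR K ⊗[K] HR K) :
          Algebra.TensorProduct.lift (antipodeHR K) (AlgHom.id K (HR K))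
            (fun _ => Commute.all _) y =
          LinearMap.mul' K (HR K) ((antipodeHR K).toLinearMap.rTensor (HR K) y) := by
        induction y using TensorProduct.induction_on with
        | zero => simp
        | add a b ha hb => simp only [map_add, ha, hb]
        | tmul a b => exact Algebra.TensorProduct.lift_tmul _ _ _ _ _
      exact (h (comulHR K x)).trans ((congrArg _ (rTensor_antipodeHR_comul K x)).trans
        (mul_antipodeOp K x)))
    (AlgHom.ext fun x => idConvAntipode_apply K x)

end HR

/-! ## The Hopf algebra of polynomials in one variable -/

section Polynomials

variable (K : Type*) [CommRing K]

/-- The bialgebra `K[x]` in which `x` is primitive. -/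
instance : Bialgebra K K[X] :=
  .ofAlgHom
    (Polynomial.aeval (Polynomial.X ⊗ₜ[K] 1 + 1 ⊗ₜ[K] Polynomial.X))
    (Polynomial.aeval 0)
    (by
      ext
      simp [Algebra.TensorProduct.one_def, TensorProduct.add_tmul, TensorProduct.tmul_add,
        add_assoc])
    (by ext; simp)
    (by ext; simp)

theorem comul_X : Coalgebra.comul (R := K) (Polynomial.X : K[X]) =
    Polynomial.X ⊗ₜ[K] 1 + 1 ⊗ₜ[K] Polynomial.X :=
  Polynomial.aeval_X _

theorem counit_X : Coalgebra.counit (R := K) (Polynomial.X : K[X]) = 0 :=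
  Polynomial.aeval_X _

instance : HopfAlgebra K K[X] :=
  .ofAlgHom (Polynomial.aeval (-Polynomial.X))
    (by
      refine Polynomial.algHom_ext ?_
      simp only [AlgHom.comp_apply, Bialgebra.comulAlgHom_apply, comul_X, map_add,
        Bialgebra.counitAlgHom_apply, counit_X, map_zero]
      refine (congrArg₂ (· + ·) (Algebra.TensorProduct.lift_tmul _ _ _ _ _)
        (Algebra.TensorProduct.lift_tmul _ _ _ _ _)).trans ?_
      simp)
    (by
      refine Polynomial.algHom_ext ?_
      simp only [AlgHom.comp_apply, Bialgebra.comulAlgHom_apply, comul_X, map_add,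
        Bialgebra.counitAlgHom_apply, counit_X, map_zero]
      refine (congrArg₂ (· + ·) (Algebra.TensorProduct.lift_tmul _ _ _ _ _)
        (Algebra.TensorProduct.lift_tmul _ _ _ _ _)).trans ?_
      simp)

end Polynomials

/-! ## The toy model -/

section Toy

variable (K : Type*) [Field K] [Algebra K ℂ]

/-- The integral operator of the toy model with kernel `f` on functions `g` of the regulator `z`
and the scale `s`: `(L g)(z, s) = ∫₀^∞ f(ζ) (s ζ)^(-z) g(z, s ζ) dζ`. -/
def toyOp (f : ℝ → ℂ) (g : ℂ → ℝ → ℂ) : ℂ → ℝ → ℂ := fun z s =>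
  ∫ ζ in Set.Ioi (0 : ℝ), f ζ * ((s * ζ : ℝ) : ℂ) ^ (-z) * g z (s * ζ)

/-- The regularized Feynman rules: the algebra morphism `φ` with `φ ∘ B₊ = L ∘ φ` on forests. -/
def toyRule (f : ℝ → ℂ) : HR K →ₐ[K] (ℂ → ℝ → ℂ) := universalHom K (toyOp f)

theorem toyRule_bPlus_forest (f : ℝ → ℂ) (x : Multiset RootedTree) (z : ℂ) (s : ℝ) :
    toyRule K f (bPlus K (forest K x)) z s =
      ∫ ζ in Set.Ioi (0 : ℝ),
        f ζ * ((s * ζ : ℝ) : ℂ) ^ (-z) * toyRule K f (forest K x) z (s * ζ) :=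
  congrFun (congrFun (universalHom_bPlus_forest K (toyOp f) x) z) s

/-- The momentum scheme: evaluation at the scale `s = μ`. -/
def momentumScheme (μ : ℝ) : (ℂ → ℝ → ℂ) →ₐ[K] (ℂ → ℝ → ℂ) where
  toFun g := fun z _ => g z μ
  map_one' := rfl
  map_mul' _ _ := rfl
  map_zero' := rfl
  map_add' _ _ := rfl
  commutes' _ := rfl

/-- The counterterm `R ∘ φ ∘ S` for the momentum scheme `R`. -/
def toyCounterterm (f : ℝ → ℂ) (μ : ℝ) : HR K →ₐ[K] (ℂ → ℝ → ℂ) :=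
  (momentumScheme K μ).comp ((toyRule K f).comp (HopfAlgebra.antipodeAlgHom K (HR K)))

/-- The renormalized Feynman rules: the convolution product of the counterterm with the
regularized Feynman rules. -/
def toyRenormalized (f : ℝ → ℂ) (μ : ℝ) : HR K →ₐ[K] (ℂ → ℝ → ℂ) :=
  (WithConv.toConv (toyCounterterm K f μ) * WithConv.toConv (toyRule K f)).ofConv

/-- The Birkhoff conditions for the splitting into the image and the kernel of the momentum
scheme: the counterterm takes values in the image and, on the augmentation ideal, the
renormalized rules take values in the kernel. -/
theorem birkhoff (f : ℝ → ℂ) (μ : ℝ) :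
    (∀ x, momentumScheme K μ (toyCounterterm K f μ x) = toyCounterterm K f μ x) ∧
      ∀ x, Coalgebra.counit (R := K) x = 0 →
        momentumScheme K μ (toyRenormalized K f μ x) = 0 := by
  refine ⟨fun _ => rfl, fun x hx => ?_⟩
  have h : (momentumScheme K μ).comp (toyRenormalized K f μ) =
      ((momentumScheme K μ).comp (toyRule K f)).comp
        (WithConv.toConv (HopfAlgebra.antipodeAlgHom K (HR K)) *
          WithConv.toConv (AlgHom.id K (HR K))).ofConv := by
    rw [toyRenormalized, AlgHom.comp_convMul_distrib, AlgHom.comp_convMul_distrib]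
    rfl
  rw [AlgHom.antipode_id_cancel] at h
  have h2 : momentumScheme K μ (toyRenormalized K f μ x) =
      momentumScheme K μ (toyRule K f (algebraMap K (HR K) (Coalgebra.counit x))) :=
    DFunLike.congr_fun h x
  rw [h2, hx, map_zero, map_zero, map_zero]

/-- The kernels `f` that are admitted for the toy model: `ζ ↦ f(ζ) ζ^(-σ)` is absolutely
integrable on `(0, ∞)` for all sufficiently small `σ > 0`, and
`F(z) = ∫₀^∞ f(ζ) ζ^(-z) dζ` has at `z = 0` a Laurent expansion `∑_{n ≥ -1} c_n z^n` with
coefficients in `K`, here `c_n = c (n + 1)`. -/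
def IsToyKernel (f : ℝ → ℂ) : Prop :=
  (∀ᶠ σ : ℝ in 𝓝[>] 0,
      MeasureTheory.IntegrableOn (fun ζ : ℝ => f ζ * (ζ : ℂ) ^ (-(σ : ℂ))) (Set.Ioi 0)) ∧
    ∃ c : ℕ → K, ∀ᶠ z : ℂ in 𝓝[{z | 0 < z.re}] 0,
      HasSum (fun n : ℕ => algebraMap K ℂ (c n) * z ^ ((n : ℤ) - 1))
        (∫ ζ in Set.Ioi (0 : ℝ), f ζ * (ζ : ℂ) ^ (-z))

/-- The limit at `z = 0` of a function given near `0` in the half-plane `Re z > 0`: that of its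
meromorphic continuation to a neighbourhood of `0`. -/
def HasPhysicalLimit (g : ℂ → ℂ) (v : ℂ) : Prop :=
  ∃ G : ℂ → ℂ, MeromorphicAt G 0 ∧ (∀ᶠ z in 𝓝[{z | 0 < z.re}] 0, g z = G z) ∧
    Filter.Tendsto G (𝓝[≠] 0) (𝓝 v)

/-- `Ψ` is the physical limit of the renormalized Feynman rules with subtraction point `μ`:
for every `x` and every scale `s > 0`, the polynomial `Ψ x` takes at `ln (s / μ)` the limit at
`z = 0` of the renormalized value of `x` as its value. -/
def IsPhysicalLimit (f : ℝ → ℂ) (μ : ℝ) (Ψ : HR K → K[X]) : Prop :=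
  ∀ (x : HR K) (s : ℝ), 0 < s →
    HasPhysicalLimit (fun z => toyRenormalized K f μ x z s)
      (Polynomial.aeval ((Real.log (s / μ) : ℝ) : ℂ) (Ψ x))

end Toy

end ToyModel

/-! Write `F(z) = H(z)/z` with `H` analytic at `0`. Since `∫ f(ζ) (sζ)^(-(k+1)z) dζ = F((k+1)z)
s^(-(k+1)z)`, the toy operator acts on polynomials in `q = s^(-z)` by `q^k ↦ F((k+1)z) q^(k+1)`. By
induction over trees every regularized value is a polynomial in `q` with meromorphic coefficients
(`toyRule_representation`); this gives convergence of the integrals and the continuation in `z`.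

The cocycle property of `B₊` and the multiplicativity of `R`, evaluation at `s = μ`, turn
renormalization into a recursion: `φ_R ∘ B₊ = (id - R) ∘ L ∘ φ_R` (`renormalize_bPlus`). With `l =
ln(s/μ)` one has `q = μ^(-z) exp(-zl)`, so multiplying the coefficient of `q^k` by `G(-kz)` amounts
to applying `G(∂)` with `∂ = d/dl`. Thus `L` is multiplication by `q` followed by `F(-∂)`. The only
singular term of `F(-∂)` is `-c 0 * ∂⁻¹`; its integration constant is a term independent of `l`, and
`id - R` removes exactly such terms. As `q → 1` for `z → 0`, the recursion has a finite limit: the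
operator `physOp c`, which is `F(-∂)` followed by dropping the constant term
(`familyOp_sub_mem_regular`).

Hence the physical limit is the character of `HR K` induced by `physOp c`. In divided powers this
operator is visibly a Hochschild 1-cocycle on `K[x]` (`comul_physOp`), so the character is a
morphism of bialgebras, and therefore of Hopf algebras. It depends only on the `c n`, not on `μ`.
Uniqueness holds because `ln(s/μ)` takes all real values.

For `1/(1+ζ)`, splitting the integral at `1` and inverting the outer part exhibits `F` as `1/z` plus
a power series. -/

namespace ToyModel

/-! ### Characters of `HR K`: antipodes, cocycles and the renormalized recursion -/

section Algebra

variable {K : Type*} [Field K]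

/-- Both `S ∘ Φ` and `Φ ∘ S` are convolution inverses of `Φ`, and inverses in the convolution group
are unique. -/
theorem bialgHom_antipode {A B : Type*} [CommRing A] [HopfAlgebra K A] [CommRing B]
    [HopfAlgebra K B] (Φ : A →ₐc[K] B) (x : A) :
    Φ (HopfAlgebra.antipode K x) = HopfAlgebra.antipode K (Φ x) := by
  have h := AlgHom.convMul_comp_bialgHom_distrib
    (WithConv.toConv (HopfAlgebra.antipodeAlgHom K B)) (WithConv.toConv (AlgHom.id K B)) Φ
  rw [AlgHom.antipode_id_cancel] at h
  have h1 : WithConv.toConv ((HopfAlgebra.antipodeAlgHom K B).comp (Φ : A →ₐ[K] B)) *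
      WithConv.toConv (Φ : A →ₐ[K] B) = 1 := by
    refine WithConv.ofConv_injective (h.symm.trans ?_)
    refine AlgHom.ext fun y => ?_
    change algebraMap K B (Coalgebra.counit (Φ y)) = algebraMap K B (Coalgebra.counit y)
    rw [CoalgHomClass.counit_comp_apply]
  have h2 := eq_inv_of_mul_eq_one_left h1
  exact (DFunLike.congr_fun (congrArg WithConv.ofConv h2) x).symm

/-- A character that intertwines `bPlus` with a Hochschild cocycle is a morphism of bialgebras. -/
theorem comul_universalHom {B : Type*} [CommRing B] [Bialgebra K B] (L : B →ₗ[K] B)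
    (hL : ∀ p, Coalgebra.comul (R := K) (L p) =
      L p ⊗ₜ[K] 1 + L.lTensor B (Coalgebra.comul (R := K) p)) :
    (Algebra.TensorProduct.map (universalHom K L) (universalHom K L)).comp
        (Bialgebra.comulAlgHom K (HR K)) =
      (Bialgebra.comulAlgHom K B).comp (universalHom K L) := by
  refine algHom_ext_bPlus fun s ih => ?_
  change TensorProduct.map (universalHom K L).toLinearMap (universalHom K L).toLinearMap
    (comulHR K (forest K s)) = Coalgebra.comul (R := K) (universalHom K L (forest K s)) at ih
  change TensorProduct.map (universalHom K L).toLinearMap (universalHom K L).toLinearMap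
    (comulHR K (bPlus K (forest K s))) =
      Coalgebra.comul (R := K) (universalHom K L (bPlus K (forest K s)))
  have h (y : HR K ⊗[K] HR K) :
      TensorProduct.map (universalHom K L).toLinearMap (universalHom K L).toLinearMap
        ((bPlus K).lTensor (HR K) y) = L.lTensor B
      (TensorProduct.map (universalHom K L).toLinearMap (universalHom K L).toLinearMap y) := by
    induction y using TensorProduct.induction_on with
    | zero => simp
    | add a b ha hb => simp only [map_add, ha, hb]
    | tmul a b => simp [universalHom_bPlus]
  rw [comulHR_bPlus, universalHom_bPlus, hL, map_add, h, ih, TensorProduct.map_tmul,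
    AlgHom.toLinearMap_apply, universalHom_bPlus, AlgHom.toLinearMap_apply, map_one]

theorem counit_universalHom {B : Type*} [CommRing B] [Bialgebra K B] (L : B →ₗ[K] B)
    (hL : ∀ p, Coalgebra.counit (R := K) (L p) = 0) :
    (Bialgebra.counitAlgHom K B).comp (universalHom K L) = Bialgebra.counitAlgHom K (HR K) := by
  refine algHom_ext_bPlus fun s _ => ?_
  change Coalgebra.counit (R := K) (universalHom K L (bPlus K (forest K s))) =
    counitHR K (bPlus K (forest K s))
  rw [universalHom_bPlus, hL, counitHR_bPlus]

/-- The convolution product of `R ∘ φ ∘ S` with `φ`. -/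
def renormalize {A : Type*} [CommRing A] [Algebra K A] (R : A →ₐ[K] A) (φ : HR K →ₐ[K] A) :
    HR K →ₐ[K] A :=
  (WithConv.toConv (R.comp (φ.comp (HopfAlgebra.antipodeAlgHom K (HR K)))) *
    WithConv.toConv φ).ofConv

/-- The cocycle identity gives `φ_R (B₊ x) = Z (B₊ x) + L (φ_R x)`, because `L` is linear over the
image of `R`, where `Z` takes its values. Applying `R` kills the left side, as `S ⋆ id = ε` and `ε ∘
B₊ = 0`; this determines `Z (B₊ x)`. -/
theorem renormalize_bPlus {A : Type*} [CommRing A] [Algebra K A] (R : A →ₐ[K] A)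
    (φ : HR K →ₐ[K] A) (L : A →ₗ[K] A) (hφ : ∀ x, φ (bPlus K x) = L (φ x))
    (hR : ∀ a, R (R a) = R a) (hL : ∀ a b, L (R a * b) = R a * L b) (x : HR K) :
    renormalize R φ (bPlus K x) =
      L (renormalize R φ x) - R (L (renormalize R φ x)) := by
  set ψ := R.comp (φ.comp (HopfAlgebra.antipodeAlgHom K (HR K))) with hψ
  have h0 (x : HR K) : renormalize R φ x =
      Algebra.TensorProduct.lift ψ φ (fun _ _ => Commute.all _ _) (comulHR K x) :=
    AlgHom.convMul_apply _ _ x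
  have h1 (y : HR K ⊗[K] HR K) :
      Algebra.TensorProduct.lift ψ φ (fun _ _ => Commute.all _ _) ((bPlus K).lTensor (HR K) y) =
      L (Algebra.TensorProduct.lift ψ φ (fun _ _ => Commute.all _ _) y) := by
    induction y using TensorProduct.induction_on with
    | zero => simp
    | add a b ha hb => simp only [map_add, ha, hb]
    | tmul a b =>
      rw [LinearMap.lTensor_tmul, Algebra.TensorProduct.lift_tmul,
        Algebra.TensorProduct.lift_tmul, hφ]
      exact (hL _ _).symm
  have h2 : renormalize R φ (bPlus K x) = ψ (bPlus K x) + L (renormalize R φ x) := by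
    rw [h0, h0, comulHR_bPlus, map_add, h1, Algebra.TensorProduct.lift_tmul, map_one, mul_one]
  have h3 : R (renormalize R φ (bPlus K x)) = 0 := by
    have h : R.comp (renormalize R φ) = (R.comp φ).comp
        (WithConv.toConv (HopfAlgebra.antipodeAlgHom K (HR K)) *
          WithConv.toConv (AlgHom.id K (HR K))).ofConv := by
      rw [renormalize, AlgHom.comp_convMul_distrib, AlgHom.comp_convMul_distrib]
      congr 3
      exact AlgHom.ext fun y => hR _
    rw [AlgHom.antipode_id_cancel] at h
    have h4 : R (renormalize R φ (bPlus K x)) =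
        R (φ (algebraMap K (HR K) (counitHR K (bPlus K x)))) := DFunLike.congr_fun h (bPlus K x)
    rw [h4, counitHR_bPlus, map_zero, map_zero, map_zero]
  have h4 : R (ψ (bPlus K x)) = ψ (bPlus K x) := hR _
  rw [h2, map_add, h4] at h3
  rw [h2, eq_neg_of_add_eq_zero_left h3]
  ring

end Algebra

/-! ### The limiting cocycle on `K[x]` -/

section Cocycle

variable {K : Type*} [Field K]

/-- The divided powers `X ^ n / n!`. -/
def dividedPower (K : Type*) [Field K] (n : ℕ) : K[X] :=
  Polynomial.monomial n ((n.factorial : K)⁻¹)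

/-- The operator that sends `X ^ m / m!` to
`-∑_{n + k = m} (-1) ^ n * c n * X ^ (k + 1) / (k + 1)!`. -/
def physOp (c : ℕ → K) : K[X] →ₗ[K] K[X] :=
  Polynomial.lsum fun m => LinearMap.toSpanSingleton K K[X]
    (-(m.factorial : K) • ∑ q ∈ Finset.HasAntidiagonal.antidiagonal m,
      ((-1) ^ q.1 * c q.1) • dividedPower K (q.2 + 1))

theorem physOp_monomial (c : ℕ → K) (m : ℕ) (a : K) :
    physOp c (Polynomial.monomial m a) = (-(a * m.factorial)) •
      ∑ q ∈ Finset.HasAntidiagonal.antidiagonal m, ((-1) ^ q.1 * c q.1) • dividedPower K (q.2 + 1) := by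
  rw [physOp, Polynomial.lsum_apply, Polynomial.sum_monomial_index _ _ (LinearMap.map_zero _),
    LinearMap.toSpanSingleton_apply, smul_smul, mul_neg]

theorem coeff_dividedPower (n m : ℕ) :
    (dividedPower K n).coeff m = if n = m then ((m.factorial : K)⁻¹) else 0 := by
  rw [dividedPower, Polynomial.coeff_monomial]
  split_ifs with h
  · rw [h]
  · rfl

theorem coeff_zero_physOp (c : ℕ → K) (p : K[X]) : (physOp c p).coeff 0 = 0 := by
  induction p using Polynomial.induction_on' with
  | add p q hp hq => rw [map_add, Polynomial.coeff_add, hp, hq, add_zero]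
  | monomial m a =>
    simp [physOp_monomial, Polynomial.finsetSum_coeff, coeff_dividedPower]

/-- The Taylor coefficients of `-∑ (-1)^n c_n ∂^(n-1) p`, in the form in which
`tendsto_sum_of_mem_regular` produces them as limits. -/
theorem coeff_succ_physOp (c : ℕ → K) (p : K[X]) (j N : ℕ) (hN : p.natDegree < N) :
    (physOp c p).coeff (j + 1) = -(((j + 1).factorial : K)⁻¹) *
      ∑ n ∈ Finset.range N, (-1) ^ n * c n * ((n + j).factorial * p.coeff (n + j)) := by
  have key (m : ℕ) (hm : m < N) (a : K) : (physOp c (Polynomial.monomial m a)).coeff (j + 1) =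
      -(((j + 1).factorial : K)⁻¹) * ∑ n ∈ Finset.range N, (-1) ^ n * c n *
        ((n + j).factorial * (Polynomial.monomial m a).coeff (n + j)) := by
    simp only [physOp_monomial, Polynomial.coeff_smul, Polynomial.finsetSum_coeff,
      coeff_dividedPower, Polynomial.coeff_monomial, smul_eq_mul, add_left_inj]
    by_cases hj : j ≤ m
    · rw [Finset.sum_eq_single (m - j, j), Finset.sum_eq_single (m - j)]
      · simp only [Nat.sub_add_cancel hj, if_true]
        ring
      · intro n _ hn
        rw [if_neg (by omega), mul_zero, mul_zero]
      · intro h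
        exact absurd (Finset.mem_range.2 (by omega)) h
      · rintro ⟨n, k⟩ hq hne
        rw [Finset.HasAntidiagonal.mem_antidiagonal] at hq
        have : k ≠ j := by rintro rfl; exact hne (Prod.ext (by simp only at *; omega) rfl)
        simp [this]
      · intro h
        exact absurd (Finset.HasAntidiagonal.mem_antidiagonal.2 (Nat.sub_add_cancel hj)) h
    · rw [Finset.sum_eq_zero, Finset.sum_eq_zero]
      · simp
      · intro n _
        rw [if_neg (by omega), mul_zero, mul_zero]
      · rintro ⟨n, k⟩ hq
        rw [Finset.HasAntidiagonal.mem_antidiagonal] at hq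
        have : k ≠ j := by simp only at hq; omega
        simp [this]
  conv_lhs => rw [p.as_sum_range' N hN, map_sum, Polynomial.finsetSum_coeff]
  rw [Finset.sum_congr rfl fun m hm => key m (Finset.mem_range.1 hm) _, ← Finset.mul_sum,
    Finset.sum_comm]
  congr 1
  refine Finset.sum_congr rfl fun n _ => ?_
  rw [← Finset.mul_sum, ← Finset.mul_sum, ← Polynomial.finsetSum_coeff, ← p.as_sum_range' N hN]

variable [CharZero K]

theorem comul_dividedPower (m : ℕ) : Coalgebra.comul (R := K) (dividedPower K m) =
    ∑ q ∈ Finset.HasAntidiagonal.antidiagonal m, dividedPower K q.1 ⊗ₜ[K] dividedPower K q.2 := by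
  have h (n : ℕ) : dividedPower K n = (n.factorial : K)⁻¹ • Polynomial.X ^ n := by
    rw [dividedPower, Polynomial.smul_X_eq_monomial]
  have hX : Coalgebra.comul (R := K) ((Polynomial.X : K[X]) ^ m) =
      (Polynomial.X ⊗ₜ[K] 1 + 1 ⊗ₜ[K] Polynomial.X) ^ m := by
    rw [← comul_X]
    exact map_pow (Bialgebra.comulAlgHom K K[X]) _ _
  rw [h, map_smul, hX, (Commute.all _ _).add_pow', Finset.smul_sum]
  refine Finset.sum_congr rfl fun q hq => ?_
  rw [h, h, TensorProduct.smul_tmul_smul, Algebra.TensorProduct.tmul_pow,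
    Algebra.TensorProduct.tmul_pow, Algebra.TensorProduct.tmul_mul_tmul, one_pow, one_pow, one_mul,
    mul_one, ← Nat.cast_smul_eq_nsmul K, smul_smul]
  congr 1
  rw [Finset.HasAntidiagonal.mem_antidiagonal] at hq
  have h3 : (m.factorial : K) ≠ 0 := by exact_mod_cast m.factorial_ne_zero
  have h4 : (q.1.factorial : K) ≠ 0 := by exact_mod_cast q.1.factorial_ne_zero
  have h5 : (q.2.factorial : K) ≠ 0 := by exact_mod_cast q.2.factorial_ne_zero
  have h6 := congrArg (Nat.cast (R := K)) (Nat.add_choose_mul_factorial_mul_factorial q.1 q.2)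
  rw [hq] at h6
  push_cast at h6
  rw [Nat.choose_symm_of_eq_add hq.symm]
  field_simp
  rw [← h6]

theorem physOp_dividedPower (c : ℕ → K) (m : ℕ) : physOp c (dividedPower K m) =
    -∑ q ∈ Finset.HasAntidiagonal.antidiagonal m, ((-1) ^ q.1 * c q.1) • dividedPower K (q.2 + 1) := by
  have h3 : (m.factorial : K) ≠ 0 := by exact_mod_cast m.factorial_ne_zero
  rw [dividedPower, physOp_monomial, inv_mul_cancel₀ h3, neg_one_smul]

/-- With `x_k = X^k / k!` one has `Δ x_(k+1) = x_(k+1) ⊗ 1 + ∑_{a+b=k} x_a ⊗ x_(b+1)`. The first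
terms assemble to `physOp c p ⊗ 1`, the others to the operator acting on the right factor. -/
theorem comul_physOp (c : ℕ → K) (p : K[X]) : Coalgebra.comul (R := K) (physOp c p) =
    physOp c p ⊗ₜ[K] 1 + (physOp c).lTensor K[X] (Coalgebra.comul (R := K) p) := by
  have key (m : ℕ) : Coalgebra.comul (R := K) (physOp c (dividedPower K m)) =
      physOp c (dividedPower K m) ⊗ₜ[K] 1 +
        (physOp c).lTensor K[X] (Coalgebra.comul (R := K) (dividedPower K m)) := by
    have h0 : dividedPower K 0 = 1 := by simp [dividedPower]
    rw [comul_dividedPower, physOp_dividedPower]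
    simp only [map_neg, map_sum, map_smul, LinearMap.lTensor_tmul, physOp_dividedPower,
      comul_dividedPower, TensorProduct.neg_tmul, TensorProduct.tmul_neg, TensorProduct.sum_tmul,
      TensorProduct.tmul_sum, Finset.sum_neg_distrib]
    rw [← neg_add, neg_inj]
    simp only [Finset.Nat.antidiagonal_succ', Finset.sum_cons, Finset.sum_map, smul_add, h0,
      Finset.sum_add_distrib, Finset.smul_sum]
    congr 1
    rw [Finset.sum_sigma', Finset.sum_sigma']
    -- Both sides sum over triples with `n + a + b = m`, grouped as `n + (a + b)` and as `a + (n +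
    -- b)`; the regrouping is an involution.
    refine Finset.sum_bij' (fun x _ => ⟨(x.2.1, x.1.1 + x.2.2), (x.1.1, x.2.2)⟩)
      (fun x _ => ⟨(x.2.1, x.1.1 + x.2.2), (x.1.1, x.2.2)⟩) ?_ ?_ ?_ ?_ ?_
    all_goals rintro ⟨⟨n, k⟩, a, b⟩ hx
    all_goals simp only [Finset.mem_sigma, Finset.HasAntidiagonal.mem_antidiagonal, Sigma.mk.injEq,
      Prod.mk.injEq, heq_eq_eq, and_true, true_and] at hx ⊢
    · omega
    · omega
    · omega
    · omega
    · rw [TensorProduct.tmul_smul]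
      rfl
  induction p using Polynomial.induction_on' with
  | add p q hp hq =>
    simp only [map_add, hp, hq, TensorProduct.add_tmul]
    abel
  | monomial m a =>
    have h3 : (m.factorial : K) ≠ 0 := by exact_mod_cast m.factorial_ne_zero
    have h : Polynomial.monomial m a = (a * m.factorial) • dividedPower K m := by
      rw [dividedPower, Polynomial.smul_monomial, smul_eq_mul, mul_inv_cancel_right₀ h3]
    simp only [h, map_smul, key, smul_add, TensorProduct.smul_tmul']

/-- The morphism of bialgebras that intertwines `bPlus` with `physOp c`. -/
def physHom (c : ℕ → K) : HR K →ₐc[K] K[X] :=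
  BialgHom.ofAlgHom (universalHom K (physOp c))
    (counit_universalHom _ fun p => by
      have h : Coalgebra.counit (R := K) (physOp c p) = (physOp c p).eval 0 :=
        Polynomial.coe_aeval_eq_eval (R := K) 0 ▸ rfl
      rw [h, ← Polynomial.coeff_zero_eq_eval_zero, coeff_zero_physOp])
    (comul_universalHom _ (comul_physOp c))

end Cocycle

/-! ### Families of polynomials in `s ^ (-z)` -/

section Families

variable {K : Type*} [Field K]

/-- Induction over trees. Taking for `A` a product of two algebras, `S` becomes a multiplicative
relation between two characters; both `representation` and `regular` are used in this way. -/
theorem mem_subalgebra_of_bPlus {A : Type*} [CommRing A] [Algebra K A] (F : HR K →ₐ[K] A)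
    (S : Subalgebra K A)
    (h : ∀ s, F (forest K s) ∈ S → F (bPlus K (forest K s)) ∈ S) (x : HR K) : F x ∈ S := by
  have h1 (t : RootedTree) : F (tree K t) ∈ S := by
    induction t using RootedTree.graft_induction with
    | h s ih =>
      rw [← bPlus_forest]
      refine h s ?_
      rw [algHom_forest]
      refine S.multiset_prod_mem fun a ha => ?_
      obtain ⟨t, ht, rfl⟩ := Multiset.mem_map.1 ha
      exact ih t ht
  have h2 : (⊤ : Submodule K (HR K)) ≤ (Subalgebra.toSubmodule S).comap F.toLinearMap := by
    rw [← (forestBasis K).span_eq, Submodule.span_le]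
    rintro _ ⟨s, rfl⟩
    change F (forestBasis K s) ∈ S
    rw [forestBasis_apply, algHom_forest]
    refine S.multiset_prod_mem fun a ha => ?_
    obtain ⟨t, -, rfl⟩ := Multiset.mem_map.1 ha
    exact h1 t
  exact h2 (Submodule.mem_top (x := x))

theorem convMul_mem_subalgebra {A B : Type*} [CommRing A] [Algebra K A] [CommRing B] [Algebra K B]
    (S : Subalgebra K (A × B)) {α β : HR K →ₐ[K] A} {α' β' : HR K →ₐ[K] B}
    (hα : ∀ x, (α x, α' x) ∈ S) (hβ : ∀ x, (β x, β' x) ∈ S) (x : HR K) :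
    ((WithConv.toConv α * WithConv.toConv β).ofConv x,
      (WithConv.toConv α' * WithConv.toConv β').ofConv x) ∈ S := by
  have h (y : HR K ⊗[K] HR K) :
      (Algebra.TensorProduct.lift α β (fun _ _ => .all _ _) y,
       Algebra.TensorProduct.lift α' β' (fun _ _ => .all _ _) y) ∈ S := by
    induction y using TensorProduct.induction_on with
    | zero =>
      rw [map_zero, map_zero]
      exact S.zero_mem
    | add a b ha hb =>
      rw [map_add, map_add]
      exact S.add_mem ha hb
    | tmul a b =>
      rw [Algebra.TensorProduct.lift_tmul, Algebra.TensorProduct.lift_tmul]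
      exact S.mul_mem (hα a) (hβ b)
  have h1 := h (comulHR K x)
  have h2 := AlgHom.convMul_apply (WithConv.toConv α) (WithConv.toConv β) x
  have h3 := AlgHom.convMul_apply (WithConv.toConv α') (WithConv.toConv β') x
  change (WithConv.toConv α * WithConv.toConv β).ofConv x = _ at h2
  change (WithConv.toConv α' * WithConv.toConv β').ofConv x = _ at h3
  rw [h2, h3]
  exact h1

/-- The linear map `X ^ k ↦ w k * X ^ (k + 1)`. -/
def shiftOp (w : ℕ → ℂ) : ℂ[X] →ₗ[ℂ] ℂ[X] :=
  Polynomial.lsum fun k => Polynomial.monomial (k + 1) ∘ₗ LinearMap.mulLeft ℂ (w k)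

theorem shiftOp_monomial (w : ℕ → ℂ) (k : ℕ) (a : ℂ) :
    shiftOp w (Polynomial.monomial k a) = Polynomial.monomial (k + 1) (w k * a) := by
  rw [shiftOp, Polynomial.lsum_apply, Polynomial.sum_monomial_index _ _ (LinearMap.map_zero _)]
  rfl

theorem coeff_shiftOp_succ (w : ℕ → ℂ) (p : ℂ[X]) (k : ℕ) :
    (shiftOp w p).coeff (k + 1) = w k * p.coeff k := by
  induction p using Polynomial.induction_on' with
  | add p q hp hq => rw [map_add, Polynomial.coeff_add, hp, hq, Polynomial.coeff_add, mul_add]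
  | monomial m a =>
    simp only [shiftOp_monomial, Polynomial.coeff_monomial, add_left_inj]
    split_ifs with h
    · rw [h]
    · rw [mul_zero]

theorem coeff_shiftOp_zero (w : ℕ → ℂ) (p : ℂ[X]) : (shiftOp w p).coeff 0 = 0 := by
  induction p using Polynomial.induction_on' with
  | add p q hp hq => rw [map_add, Polynomial.coeff_add, hp, hq, add_zero]
  | monomial m a => simp [shiftOp_monomial, Polynomial.coeff_monomial]

theorem natDegree_shiftOp_le (w : ℕ → ℂ) (p : ℂ[X]) {N : ℕ} (hN : p.natDegree ≤ N) :
    (shiftOp w p).natDegree ≤ N + 1 := by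
  rw [Polynomial.natDegree_le_iff_coeff_eq_zero]
  intro m hm
  obtain ⟨k, rfl⟩ : ∃ k, m = k + 1 := ⟨m - 1, by omega⟩
  rw [coeff_shiftOp_succ, Polynomial.coeff_eq_zero_of_natDegree_lt (by omega), mul_zero]

theorem eval_shiftOp (w : ℕ → ℂ) (p : ℂ[X]) {N : ℕ} (hN : p.natDegree ≤ N) (q : ℂ) :
    (shiftOp w p).eval q = ∑ k ∈ Finset.range (N + 1), w k * p.coeff k * q ^ (k + 1) := by
  rw [Polynomial.eval_eq_sum_range' (Nat.lt_succ_of_le (natDegree_shiftOp_le w p hN)),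
    Finset.sum_range_succ', coeff_shiftOp_zero, zero_mul, add_zero]
  simp only [coeff_shiftOp_succ]

variable [Algebra K ℂ]

variable (K) in
/-- On families of polynomials in `s ^ (-z)` this is the operator of the toy model with Mellin
transform `G`. -/
def familyOp (G : ℂ → ℂ) : (ℂ → ℂ[X]) →ₗ[K] (ℂ → ℂ[X]) :=
  LinearMap.pi fun z => (shiftOp fun k => G ((k + 1) * z)).restrictScalars K ∘ₗ LinearMap.proj z

theorem familyOp_apply (G : ℂ → ℂ) (a : ℂ → ℂ[X]) (z : ℂ) :
    familyOp K G a z = shiftOp (fun k => G ((k + 1) * z)) (a z) := rfl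

variable (K) in
/-- The evaluation of families of polynomials at the point `u z`, seen as constants. -/
def familyEval (u : ℂ → ℂ) : (ℂ → ℂ[X]) →ₐ[K] (ℂ → ℂ[X]) where
  toFun a z := Polynomial.C ((a z).eval (u z))
  map_one' := by ext1 z; simp
  map_mul' _ _ := by ext1 z; simp
  map_zero' := by ext1 z; simp
  map_add' _ _ := by ext1 z; simp
  commutes' r := by
    ext1 z
    simp [Polynomial.algebraMap_apply]

theorem familyEval_apply (u : ℂ → ℂ) (a : ℂ → ℂ[X]) (z : ℂ) :
    familyEval K u a z = Polynomial.C ((a z).eval (u z)) := rfl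

theorem familyEval_idem (u : ℂ → ℂ) (a : ℂ → ℂ[X]) :
    familyEval K u (familyEval K u a) = familyEval K u a := by
  ext1 z
  simp [familyEval_apply]

theorem familyOp_familyEval_mul (G u : ℂ → ℂ) (a b : ℂ → ℂ[X]) :
    familyOp K G (familyEval K u a * b) = familyEval K u a * familyOp K G b := by
  ext1 z
  simp [familyOp_apply, familyEval_apply, ← Polynomial.smul_eq_C_mul]

/-- Families of polynomials of bounded degree that represent functions of the regulator and the
scale. -/
def representation (K : Type*) [Field K] [Algebra K ℂ] :
    Subalgebra K ((ℂ → ℝ → ℂ) × (ℂ → ℂ[X])) where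
  carrier := {p | (∃ N, ∀ z, (p.2 z).natDegree ≤ N) ∧
    ∀ᶠ z : ℂ in 𝓝[{z | 0 < z.re}] 0, ∀ s : ℝ, 0 < s →
      p.1 z s = (p.2 z).eval ((s : ℂ) ^ (-z))}
  mul_mem' := by
    rintro ⟨g, a⟩ ⟨h, b⟩ ⟨⟨N, hN⟩, hg⟩ ⟨⟨M, hM⟩, hh⟩
    refine ⟨⟨N + M, fun z => Polynomial.natDegree_mul_le_of_le (hN z) (hM z)⟩, ?_⟩
    filter_upwards [hg, hh] with z h1 h2 s hs
    have h1 := h1 s hs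
    have h2 := h2 s hs
    simp only [Prod.mk_mul_mk, Pi.mul_apply, Polynomial.eval_mul] at *
    rw [h1, h2]
  add_mem' := by
    rintro ⟨g, a⟩ ⟨h, b⟩ ⟨⟨N, hN⟩, hg⟩ ⟨⟨M, hM⟩, hh⟩
    refine ⟨⟨max N M, fun z => Polynomial.natDegree_add_le_of_le (hN z) (hM z)⟩, ?_⟩
    filter_upwards [hg, hh] with z h1 h2 s hs
    have h1 := h1 s hs
    have h2 := h2 s hs
    simp only [Prod.mk_add_mk, Pi.add_apply, Polynomial.eval_add] at *
    rw [h1, h2]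
  algebraMap_mem' r := by
    refine ⟨⟨0, fun z => ?_⟩, .of_forall fun z s _ => ?_⟩
    · simp [Polynomial.algebraMap_apply]
    · simp [Polynomial.algebraMap_apply]

end Families

/-! ### The Mellin transform of the kernel near `0` -/

section Kernel

theorem tendsto_natCast_mul_halfPlane (k : ℕ) :
    Filter.Tendsto (fun z : ℂ => ((k : ℂ) + 1) * z) (𝓝[{z | 0 < z.re}] 0)
      (𝓝[{z | 0 < z.re}] 0) := by
  refine tendsto_nhdsWithin_iff.2 ⟨?_, ?_⟩
  · have h : Continuous fun z : ℂ => ((k : ℂ) + 1) * z := by fun_prop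
    simpa using (h.tendsto 0).mono_left nhdsWithin_le_nhds
  · filter_upwards [self_mem_nhdsWithin] with z hz
    have h : (((k : ℂ) + 1) * z).re = (k + 1) * z.re := by
      simp [Complex.mul_re]
    change 0 < (((k : ℂ) + 1) * z).re
    rw [h]
    exact mul_pos (by positivity) hz

theorem halfPlane_le_punctured : 𝓝[{z : ℂ | 0 < z.re}] 0 ≤ 𝓝[≠] 0 :=
  nhdsWithin_mono _ fun z (hz : 0 < z.re) h => by
    rw [Set.mem_singleton_iff] at h
    simp [h] at hz

instance halfPlane_neBot : (𝓝[{z : ℂ | 0 < z.re}] 0).NeBot := by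
  rw [← mem_closure_iff_nhdsWithin_neBot]
  have h : Filter.Tendsto (fun n : ℕ => ((1 / ((n : ℝ) + 1) : ℝ) : ℂ)) Filter.atTop (𝓝 0) :=
    (Complex.continuous_ofReal.tendsto' 0 0 Complex.ofReal_zero).comp
      tendsto_one_div_add_atTop_nhds_zero_nat
  refine mem_closure_of_tendsto h (.of_forall fun n => ?_)
  change 0 < (((1 / ((n : ℝ) + 1) : ℝ) : ℂ)).re
  rw [Complex.ofReal_re]
  positivity

theorem eventually_integrableOn_kernel {f : ℝ → ℂ}
    (hf : ∀ᶠ σ : ℝ in 𝓝[>] 0,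
      MeasureTheory.IntegrableOn (fun ζ : ℝ => f ζ * (ζ : ℂ) ^ (-(σ : ℂ))) (Set.Ioi 0)) :
    ∀ᶠ z : ℂ in 𝓝[{z | 0 < z.re}] 0,
      MeasureTheory.IntegrableOn (fun ζ : ℝ => f ζ * (ζ : ℂ) ^ (-z)) (Set.Ioi 0) := by
  have h : Filter.Tendsto Complex.re (𝓝[{z | 0 < z.re}] 0) (𝓝[>] 0) := by
    refine tendsto_nhdsWithin_iff.2 ⟨?_, self_mem_nhdsWithin⟩
    simpa using (Complex.continuous_re.tendsto 0).mono_left nhdsWithin_le_nhds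
  -- Only `Re z` matters for absolute integrability: the factor `ζ^(-i Im z)` has modulus one.
  filter_upwards [h.eventually hf] with z hz
  have h1 : MeasureTheory.IntegrableOn (fun ζ : ℝ => f ζ * (ζ : ℂ) ^ (-(z.re : ℂ)) *
      (ζ : ℂ) ^ (-(z.im * Complex.I))) (Set.Ioi 0) := by
    refine MeasureTheory.Integrable.mul_bdd (c := 1) hz ?_ ?_
    · exact (Complex.measurable_ofReal.pow_const _).aestronglyMeasurable
    · refine (MeasureTheory.ae_restrict_mem measurableSet_Ioi).mono fun ζ hζ => ?_
      rw [Complex.norm_cpow_eq_rpow_re_of_pos hζ]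
      simp
  refine h1.congr_fun (fun ζ hζ => ?_) measurableSet_Ioi
  have h2 : (ζ : ℂ) ≠ 0 := Complex.ofReal_ne_zero.2 (ne_of_gt hζ)
  simp only
  rw [mul_assoc, ← Complex.cpow_add _ _ h2, ← neg_add, Complex.re_add_im]

/-- Convergence at a single `z ≠ 0` forces `c n * z ^ n → 0`, so the radius of convergence is
positive. The half-plane data thus extend to a function analytic on a full neighbourhood of `0`, the
source of all meromorphic continuations below. -/
theorem exists_hasFPowerSeriesAt {F : ℂ → ℂ} {c : ℕ → ℂ}
    (h : ∀ᶠ z : ℂ in 𝓝[{z | 0 < z.re}] 0, HasSum (fun n : ℕ => c n * z ^ ((n : ℤ) - 1)) (F z)) :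
    ∃ H : ℂ → ℂ, HasFPowerSeriesAt H (FormalMultilinearSeries.ofScalars ℂ c) 0 ∧
      ∀ᶠ z : ℂ in 𝓝[{z | 0 < z.re}] 0, F z = H z / z := by
  set p := FormalMultilinearSeries.ofScalars ℂ c with hp
  have h1 : ∀ᶠ z : ℂ in 𝓝[{z | 0 < z.re}] 0, HasSum (fun n : ℕ => c n * z ^ n) (F z * z) := by
    filter_upwards [h, halfPlane_le_punctured self_mem_nhdsWithin] with z hz hz0
    refine (hz.mul_right z).congr_fun fun n => ?_
    rw [mul_assoc, ← zpow_add_one₀ hz0, sub_add_cancel, zpow_natCast]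
  have hnorm (n : ℕ) : ‖p n‖ = ‖c n‖ := by
    rw [FormalMultilinearSeries.norm_apply_eq_norm_coef, hp]
    exact congrArg _ FormalMultilinearSeries.coeff_ofScalars
  have hr : 0 < p.radius := by
    obtain ⟨z, hz, hz0⟩ := (h1.and (halfPlane_le_punctured self_mem_nhdsWithin)).exists
    have h2 : ((‖z‖₊ : NNReal) : ENNReal) ≤ p.radius := by
      refine FormalMultilinearSeries.le_radius_of_tendsto p (l := 0) ?_
      simpa [hnorm] using hz.summable.tendsto_atTop_zero.norm
    refine lt_of_lt_of_le ?_ h2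
    rw [ENNReal.coe_pos]
    exact nnnorm_pos.2 hz0
  refine ⟨p.sum, (p.hasFPowerSeriesOnBall hr).hasFPowerSeriesAt, ?_⟩
  filter_upwards [h1, halfPlane_le_punctured self_mem_nhdsWithin] with z hz hz0
  have h2 : p.sum z = F z * z := by
    refine Eq.trans ?_ hz.tsum_eq
    refine tsum_congr fun n => ?_
    rw [hp, FormalMultilinearSeries.ofScalars_apply_eq, smul_eq_mul]
  rw [h2, mul_div_cancel_right₀ _ hz0]

end Kernel

/-! ### Regularized and renormalized rules as families of polynomials -/

section Representation

variable {K : Type*} [Field K] [Algebra K ℂ] {f : ℝ → ℂ} {G : ℂ → ℂ}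

theorem toyOp_representation
    (hf : ∀ᶠ z : ℂ in 𝓝[{z | 0 < z.re}] 0,
      MeasureTheory.IntegrableOn (fun ζ : ℝ => f ζ * (ζ : ℂ) ^ (-z)) (Set.Ioi 0))
    (hG : ∀ᶠ z : ℂ in 𝓝[{z | 0 < z.re}] 0, ∫ ζ in Set.Ioi (0 : ℝ), f ζ * (ζ : ℂ) ^ (-z) = G z)
    {g : ℂ → ℝ → ℂ} {a : ℂ → ℂ[X]} (hg : (g, a) ∈ representation K) :
    (∀ᶠ z : ℂ in 𝓝[{z | 0 < z.re}] 0, ∀ s : ℝ, 0 < s → MeasureTheory.IntegrableOn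
      (fun ζ : ℝ => f ζ * ((s * ζ : ℝ) : ℂ) ^ (-z) * g z (s * ζ)) (Set.Ioi 0)) ∧
    (toyOp f g, familyOp K G a) ∈ representation K := by
  obtain ⟨⟨N, hN⟩, hg⟩ := hg
  -- The degree bound `N` is uniform in `z`, so only finitely many dilates `(k + 1) z` have to lie
  -- in the good region. That region does not depend on `s`, as is necessary because the integrand
  -- involves all scales `s * ζ`.
  have hf' : ∀ᶠ z : ℂ in 𝓝[{z | 0 < z.re}] 0, ∀ k ∈ Finset.range (N + 1),
      MeasureTheory.IntegrableOn (fun ζ : ℝ => f ζ * (ζ : ℂ) ^ (-(((k : ℂ) + 1) * z)))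
        (Set.Ioi 0) :=
    (Filter.eventually_all_finset _).2 fun k _ => (tendsto_natCast_mul_halfPlane k).eventually hf
  have hG' : ∀ᶠ z : ℂ in 𝓝[{z | 0 < z.re}] 0, ∀ k ∈ Finset.range (N + 1),
      ∫ ζ in Set.Ioi (0 : ℝ), f ζ * (ζ : ℂ) ^ (-(((k : ℂ) + 1) * z)) = G (((k : ℂ) + 1) * z) :=
    (Filter.eventually_all_finset _).2 fun k _ => (tendsto_natCast_mul_halfPlane k).eventually hG
  have key : ∀ᶠ z : ℂ in 𝓝[{z | 0 < z.re}] 0, ∀ s : ℝ, 0 < s → ∀ ζ ∈ Set.Ioi (0 : ℝ),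
      ∑ k ∈ Finset.range (N + 1), (a z).coeff k * ((s : ℂ) ^ (-z)) ^ (k + 1) *
        (f ζ * (ζ : ℂ) ^ (-(((k : ℂ) + 1) * z))) =
      f ζ * ((s * ζ : ℝ) : ℂ) ^ (-z) * g z (s * ζ) := by
    filter_upwards [hg] with z hz s hs ζ hζ
    have h1 : ((s * ζ : ℝ) : ℂ) ^ (-z) = (s : ℂ) ^ (-z) * (ζ : ℂ) ^ (-z) := by
      rw [Complex.ofReal_mul, Complex.mul_cpow_ofReal_nonneg hs.le (le_of_lt hζ)]
    have h2 : g z (s * ζ) = (a z).eval (((s * ζ : ℝ) : ℂ) ^ (-z)) := hz _ (mul_pos hs hζ)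
    rw [h2, Polynomial.eval_eq_sum_range' (Nat.lt_succ_of_le (hN z)), Finset.mul_sum]
    refine Finset.sum_congr rfl fun k _ => ?_
    have h3 : (ζ : ℂ) ^ (-(((k : ℂ) + 1) * z)) = ((ζ : ℂ) ^ (-z)) ^ (k + 1) := by
      rw [← Complex.cpow_nat_mul]
      congr 1
      push_cast
      ring
    rw [h1, h3]
    ring
  refine ⟨?_, ⟨N + 1, fun z => natDegree_shiftOp_le _ _ (hN z)⟩, ?_⟩
  · filter_upwards [hf', key] with z h1 h2 s hs
    refine MeasureTheory.IntegrableOn.congr_fun ?_ (h2 s hs) measurableSet_Ioi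
    exact MeasureTheory.integrable_finsetSum _ fun k hk => (h1 k hk).const_mul _
  · filter_upwards [hf', hG', key] with z h1 h3 h2 s hs
    change ∫ ζ in Set.Ioi (0 : ℝ), f ζ * ((s * ζ : ℝ) : ℂ) ^ (-z) * g z (s * ζ) =
      (shiftOp (fun k => G ((k + 1) * z)) (a z)).eval _
    rw [← MeasureTheory.setIntegral_congr_fun measurableSet_Ioi (h2 s hs),
      MeasureTheory.integral_finsetSum _ fun k hk => (h1 k hk).const_mul _,
      eval_shiftOp _ _ (hN z)]
    refine Finset.sum_congr rfl fun k hk => ?_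
    rw [MeasureTheory.integral_const_mul, h3 k hk]
    ring

theorem toyRule_representation
    (hf : ∀ᶠ z : ℂ in 𝓝[{z | 0 < z.re}] 0,
      MeasureTheory.IntegrableOn (fun ζ : ℝ => f ζ * (ζ : ℂ) ^ (-z)) (Set.Ioi 0))
    (hG : ∀ᶠ z : ℂ in 𝓝[{z | 0 < z.re}] 0, ∫ ζ in Set.Ioi (0 : ℝ), f ζ * (ζ : ℂ) ^ (-z) = G z)
    (x : HR K) : (toyRule K f x, universalHom K (familyOp K G) x) ∈ representation K := by
  refine mem_subalgebra_of_bPlus ((toyRule K f).prod (universalHom K (familyOp K G)))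
    (representation K) (fun s hs => ?_) x
  have h := (toyOp_representation hf hG hs).2
  rw [AlgHom.prod_apply]
  rw [universalHom_bPlus]
  -- `toyOp f` is not known to be linear, since divergent integrals take the default value `0`; only
  -- its identity on forests is available.
  rw [toyRule, universalHom_bPlus_forest]
  exact h

theorem toyRenormalized_representation
    (hf : ∀ᶠ z : ℂ in 𝓝[{z | 0 < z.re}] 0,
      MeasureTheory.IntegrableOn (fun ζ : ℝ => f ζ * (ζ : ℂ) ^ (-z)) (Set.Ioi 0))
    (hG : ∀ᶠ z : ℂ in 𝓝[{z | 0 < z.re}] 0, ∫ ζ in Set.Ioi (0 : ℝ), f ζ * (ζ : ℂ) ^ (-z) = G z)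
    {μ : ℝ} (hμ : 0 < μ) (x : HR K) :
    (toyRenormalized K f μ x, renormalize (familyEval K fun z => (μ : ℂ) ^ (-z))
      (universalHom K (familyOp K G)) x) ∈ representation K := by
  refine convMul_mem_subalgebra _ (fun y => ?_) (toyRule_representation hf hG) x
  obtain ⟨-, h⟩ := toyRule_representation hf hG (HopfAlgebra.antipode K y)
  refine ⟨⟨0, fun z => (Polynomial.natDegree_C _).le⟩, ?_⟩
  filter_upwards [h] with z hz s _
  refine (hz μ hμ).trans ?_
  exact Polynomial.eval_C.symm

end Representation

/-! ### Taylor expansion in `l = ln (s / μ)` and remainder estimates -/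

section Taylor

/-- The expansion in `l` of a polynomial at the point `q * exp (-z * l)`. -/
def taylorHom (q z : ℂ) : ℂ[X] →ₐ[ℂ] PowerSeries ℂ :=
  Polynomial.aeval (PowerSeries.C q * PowerSeries.rescale (-z) (PowerSeries.exp ℂ))

theorem coeff_taylorHom (q z : ℂ) (p : ℂ[X]) {N : ℕ} (hN : p.natDegree ≤ N) (j : ℕ) :
    PowerSeries.coeff j (taylorHom q z p) = ∑ k ∈ Finset.range (N + 1),
      p.coeff k * q ^ k * (-(k * z)) ^ j / j.factorial := by
  rw [taylorHom, Polynomial.aeval_eq_sum_range' (Nat.lt_succ_of_le hN), map_sum]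
  refine Finset.sum_congr rfl fun k _ => ?_
  rw [mul_pow, ← map_pow, ← map_pow, PowerSeries.exp_pow_eq_rescale_exp,
    PowerSeries.coeff_smul, PowerSeries.coeff_C_mul, PowerSeries.coeff_rescale,
    PowerSeries.coeff_rescale, PowerSeries.coeff_exp]
  simp only [smul_eq_mul, map_div₀, map_one, map_natCast]
  rw [show -((k : ℂ) * z) = -z * k by ring, mul_pow]
  ring

theorem exists_tendsto_mul_zero {b : ℂ → ℂ} (hb : MeromorphicAt b 0) :
    ∃ n : ℕ, ∀ M, n < M → ∀ r : ℂ → ℂ, r =O[𝓝[≠] 0] (fun z => z ^ M) →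
      Filter.Tendsto (fun z => b z * r z) (𝓝[≠] 0) (𝓝 0) := by
  obtain ⟨n, hn⟩ := hb
  refine ⟨n, fun M hM r hr => ?_⟩
  have h1 : Filter.Tendsto (fun z : ℂ => (z - 0) ^ n • b z) (𝓝[≠] 0) (𝓝 _) :=
    hn.continuousAt.tendsto.mono_left nhdsWithin_le_nhds
  have h2 : Filter.Tendsto (fun z : ℂ => r z / z ^ n) (𝓝[≠] 0) (𝓝 0) :=
    (hr.trans_isLittleO ((Asymptotics.isLittleO_pow_pow hM).mono
      nhdsWithin_le_nhds)).tendsto_div_nhds_zero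
  have h3 := h1.mul h2
  rw [mul_zero] at h3
  refine h3.congr' ?_
  filter_upwards [self_mem_nhdsWithin] with z hz
  have h4 : z ^ n ≠ 0 := pow_ne_zero _ hz
  rw [sub_zero, smul_eq_mul]
  field_simp

theorem isBigO_sub_partialSum {H : ℂ → ℂ} {h : ℕ → ℂ}
    (hH : ∀ᶠ w in 𝓝 0, HasSum (fun n => h n * w ^ n) (H w)) (t : ℂ) (M : ℕ) :
    (fun z => H (t * z) - ∑ n ∈ Finset.range M, h n * (t * z) ^ n) =O[𝓝[≠] 0]
      (fun z => z ^ M) := by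
  have h1 : HasFPowerSeriesAt H (FormalMultilinearSeries.ofScalars ℂ h) 0 := by
    rw [hasFPowerSeriesAt_iff]
    simpa [FormalMultilinearSeries.coeff_ofScalars, mul_comm] using hH
  have h2 : Filter.Tendsto (fun z : ℂ => t * z) (𝓝[≠] 0) (𝓝 0) := by
    have h : Continuous fun z : ℂ => t * z := by fun_prop
    simpa using (h.tendsto 0).mono_left nhdsWithin_le_nhds
  have h3 := (h1.isBigO_sub_partialSum_pow M).comp_tendsto h2
  have h4 : (fun z => H (t * z) - ∑ n ∈ Finset.range M, h n * (t * z) ^ n) =O[𝓝[≠] 0]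
      (fun z => ‖t * z‖ ^ M) := by
    refine h3.congr_left fun z => ?_
    simp [FormalMultilinearSeries.partialSum, mul_comm]
  refine h4.trans (Asymptotics.IsBigO.of_bound (‖t‖ ^ M) (.of_forall fun z => ?_))
  simp [mul_pow]

end Taylor

/-! ### Families with a limit at `z = 0`, and the limit of the recursion -/

section Regular

variable {K : Type*} [Field K] [Algebra K ℂ]

variable (K) in
/-- Families of polynomials whose values at `u z * exp (-z * l)` have Taylor coefficients in `l`
that converge for `z → 0` to those of a polynomial. -/
def regular (u : ℂ → ℂ) : Subalgebra K ((ℂ → ℂ[X]) × K[X]) where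
  carrier := {q | (∃ N, ∀ z, (q.1 z).natDegree ≤ N) ∧
    (∀ k, MeromorphicAt (fun z => (q.1 z).coeff k) 0) ∧
    ∀ j, Filter.Tendsto (fun z => PowerSeries.coeff j (taylorHom (u z) z (q.1 z))) (𝓝[≠] 0)
      (𝓝 (algebraMap K ℂ (q.2.coeff j)))}
  mul_mem' := by
    rintro ⟨a, p⟩ ⟨b, q⟩ ⟨⟨N, hN⟩, ha, ha'⟩ ⟨⟨M, hM⟩, hb, hb'⟩
    refine ⟨⟨N + M, fun z => Polynomial.natDegree_mul_le_of_le (hN z) (hM z)⟩, fun k => ?_,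
      fun j => ?_⟩
    · simp only [Prod.mk_mul_mk, Pi.mul_apply, Polynomial.coeff_mul]
      exact MeromorphicAt.fun_sum fun i _ => (ha _).mul (hb _)
    · simp only [Prod.mk_mul_mk, Pi.mul_apply, Polynomial.coeff_mul, map_mul,
        PowerSeries.coeff_mul, map_sum]
      exact tendsto_finsetSum _ fun i _ => (ha' _).mul (hb' _)
  add_mem' := by
    rintro ⟨a, p⟩ ⟨b, q⟩ ⟨⟨N, hN⟩, ha, ha'⟩ ⟨⟨M, hM⟩, hb, hb'⟩
    refine ⟨⟨max N M, fun z => Polynomial.natDegree_add_le_of_le (hN z) (hM z)⟩, fun k => ?_,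
      fun j => ?_⟩
    · simp only [Prod.mk_add_mk, Pi.add_apply, Polynomial.coeff_add]
      exact (ha _).add (hb _)
    · simp only [Prod.mk_add_mk, Pi.add_apply, Polynomial.coeff_add, map_add]
      exact (ha' _).add (hb' _)
  algebraMap_mem' r := by
    refine ⟨⟨0, fun z => ?_⟩, fun k => ?_, fun j => ?_⟩
    · simp [Polynomial.algebraMap_apply]
    · exact MeromorphicAt.const _ _
    · refine tendsto_const_nhds.congr fun z => ?_
      simp only [Prod.algebraMap_apply, Pi.algebraMap_apply, Polynomial.algebraMap_apply,
        Algebra.algebraMap_self, RingHom.id_apply, taylorHom, Polynomial.aeval_C,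
        PowerSeries.algebraMap_apply, PowerSeries.coeff_C, Polynomial.coeff_C]
      split_ifs <;> simp

variable {u : ℂ → ℂ}

/-- The variable `q = u z * exp (-z * l)` tends coefficientwise to `1`, so the extra factor `q`
produced by the toy operator disappears in the limit. -/
theorem X_mem_regular (hu : AnalyticAt ℂ u 0) (hu0 : u 0 = 1) :
    ((fun _ => Polynomial.X, 1) : (ℂ → ℂ[X]) × K[X]) ∈ regular K u := by
  refine ⟨⟨1, fun z => Polynomial.natDegree_X_le⟩, fun k => MeromorphicAt.const _ _, fun j => ?_⟩
  have h : ContinuousAt (fun z => u z * (-z) ^ j / (j.factorial : ℂ)) 0 := by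
    have := hu.continuousAt
    fun_prop
  have h1 := h.tendsto.mono_left (nhdsWithin_le_nhds (s := {0}ᶜ))
  have h2 : u 0 * (-0) ^ j / (j.factorial : ℂ) = algebraMap K ℂ ((1 : K[X]).coeff j) := by
    rw [hu0, Polynomial.coeff_one]
    rcases j with _ | j <;> simp
  rw [h2] at h1
  refine h1.congr fun z => ?_
  simp [taylorHom, PowerSeries.coeff_C_mul, PowerSeries.coeff_rescale, PowerSeries.coeff_exp]
  ring

/-- The sum is `∂^i H(∂)` applied to the family and evaluated at `l = 0`, with `∂ = d/dl`; the limit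
is the same expression for `p`. Expanding `H` gives Taylor coefficients, which converge by
assumption. The individual coefficients may have poles, but these are of finite order, so a
sufficiently late remainder of the series of `H` overcomes them. -/
theorem tendsto_sum_of_mem_regular (hu : AnalyticAt ℂ u 0) {a : ℂ → ℂ[X]} {p : K[X]}
    (hap : (a, p) ∈ regular K u) {H : ℂ → ℂ} {h : ℕ → ℂ}
    (hH : ∀ᶠ w in 𝓝 0, HasSum (fun n => h n * w ^ n) (H w)) (i : ℕ) {M N : ℕ}
    (hM : p.natDegree < M) (hN : ∀ z, (a z).natDegree ≤ N) :
    Filter.Tendsto (fun z => ∑ k ∈ Finset.range (N + 1),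
        (a z).coeff k * u z ^ k * (-(k * z)) ^ i * H (-(k * z))) (𝓝[≠] 0)
      (𝓝 (∑ n ∈ Finset.range M, h n * ((n + i).factorial * algebraMap K ℂ (p.coeff (n + i))))) := by
  obtain ⟨-, hmer, htay⟩ := hap
  have hu' (k : ℕ) : MeromorphicAt (fun z => (a z).coeff k * u z ^ k * (-(k * z)) ^ i) 0 := by
    have h1 : MeromorphicAt u 0 := hu.meromorphicAt
    have h2 := hmer k
    fun_prop
  choose n hn using fun k => exists_tendsto_mul_zero (hu' k)
  -- `M'` exceeds all the exponents `n k` bounding the pole orders, so the remainders vanish in the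
  -- limit, and it exceeds `deg p`, so the additional terms of the limit are zero.
  set M' := M + (∑ k ∈ Finset.range (N + 1), n k) + 1 with hM'
  have hrem : Filter.Tendsto (fun z => ∑ k ∈ Finset.range (N + 1),
      (a z).coeff k * u z ^ k * (-(k * z)) ^ i *
        (H (-(k * z)) - ∑ n ∈ Finset.range M', h n * (-(k * z)) ^ n)) (𝓝[≠] 0) (𝓝 0) := by
    have h0 : (0 : ℂ) = ∑ k ∈ Finset.range (N + 1), 0 := Finset.sum_const_zero.symm
    rw [show 𝓝 (0 : ℂ) = 𝓝 (∑ k ∈ Finset.range (N + 1), 0) from congrArg _ h0]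
    refine tendsto_finsetSum _ fun k hk => hn k M' ?_ _ ?_
    · have := Finset.single_le_sum (fun i _ => Nat.zero_le (n i)) hk
      omega
    · simpa only [neg_mul] using isBigO_sub_partialSum hH (-k) M'
  have hmain : Filter.Tendsto (fun z => ∑ n ∈ Finset.range M', h n * ((n + i).factorial *
      PowerSeries.coeff (n + i) (taylorHom (u z) z (a z)))) (𝓝[≠] 0)
      (𝓝 (∑ n ∈ Finset.range M',
        h n * ((n + i).factorial * algebraMap K ℂ (p.coeff (n + i))))) :=
    tendsto_finsetSum _ fun n _ => ((htay _).const_mul _).const_mul _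
  have hlim : ∑ n ∈ Finset.range M, h n * ((n + i).factorial * algebraMap K ℂ (p.coeff (n + i))) =
      ∑ n ∈ Finset.range M', h n * ((n + i).factorial * algebraMap K ℂ (p.coeff (n + i))) := by
    refine Finset.sum_subset (Finset.range_mono (by omega)) fun n _ hn => ?_
    rw [Finset.mem_range] at hn
    rw [Polynomial.coeff_eq_zero_of_natDegree_lt (by omega), map_zero, mul_zero, mul_zero]
  rw [hlim, ← add_zero (∑ n ∈ Finset.range M', _)]
  refine (hmain.add hrem).congr fun z => ?_
  simp only [coeff_taylorHom _ _ _ (hN z), mul_sub, Finset.sum_sub_distrib, Finset.mul_sum]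
  rw [Finset.sum_comm, ← add_sub_assoc, add_comm, add_sub_assoc, add_eq_left, sub_eq_zero]
  refine Finset.sum_congr rfl fun k _ => Finset.sum_congr rfl fun n _ => ?_
  have h1 : ((n + i).factorial : ℂ) ≠ 0 := by exact_mod_cast (n + i).factorial_ne_zero
  rw [pow_add]
  field_simp

/-- Evaluation at `l` is `exp(l ∂)` followed by evaluation at `0`: the case `H w = exp (l * w)`, `i
= 0` of `tendsto_sum_of_mem_regular`. -/
theorem tendsto_eval_of_mem_regular (hu : AnalyticAt ℂ u 0) {a : ℂ → ℂ[X]} {p : K[X]}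
    (hap : (a, p) ∈ regular K u) (l : ℂ) :
    Filter.Tendsto (fun z => (a z).eval (u z * Complex.exp (-(z * l)))) (𝓝[≠] 0)
      (𝓝 (Polynomial.aeval l p)) := by
  obtain ⟨N, hN⟩ := hap.1
  have hH : ∀ᶠ w : ℂ in 𝓝 0, HasSum (fun n : ℕ => l ^ n / (n.factorial : ℂ) * w ^ n)
      (Complex.exp (l * w)) := .of_forall fun w => by
    have h := NormedSpace.expSeries_div_hasSum_exp (l * w)
    rw [← Complex.exp_eq_exp_ℂ] at h
    refine h.congr_fun fun n => ?_
    rw [mul_pow]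
    ring
  have h := tendsto_sum_of_mem_regular hu hap hH 0 (Nat.lt_succ_self _) hN
  have h1 : ∑ n ∈ Finset.range (p.natDegree + 1), l ^ n / (n.factorial : ℂ) *
      ((n + 0).factorial * algebraMap K ℂ (p.coeff (n + 0))) = Polynomial.aeval l p := by
    rw [Polynomial.aeval_eq_sum_range]
    refine Finset.sum_congr rfl fun n _ => ?_
    have h1 : (n.factorial : ℂ) ≠ 0 := by exact_mod_cast n.factorial_ne_zero
    rw [add_zero, Algebra.smul_def]
    field_simp
  rw [Nat.succ_eq_add_one, h1] at h
  refine h.congr fun z => ?_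
  rw [Polynomial.eval_eq_sum_range' (Nat.lt_succ_of_le (hN z))]
  refine Finset.sum_congr rfl fun k _ => ?_
  rw [mul_pow, ← Complex.exp_nat_mul, pow_zero, mul_one, mul_assoc,
    show (k : ℂ) * -(z * l) = l * -(k * z) by ring]

theorem meromorphicAt_eval {a : ℂ → ℂ[X]} {N : ℕ} (hN : ∀ z, (a z).natDegree ≤ N)
    (ha : ∀ k, MeromorphicAt (fun z => (a z).coeff k) 0) {v : ℂ → ℂ} (hv : MeromorphicAt v 0) :
    MeromorphicAt (fun z => (a z).eval (v z)) 0 := by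
  simp only [fun z => Polynomial.eval_eq_sum_range' (Nat.lt_succ_of_le (hN z)) (v z)]
  exact MeromorphicAt.fun_sum fun k _ => (ha k).mul (hv.pow k)

/-- The coefficient of `l^(j+1)` carries a factor `(-(k + 1) z)^(j+1)`, which cancels the
denominator of `H((k + 1) z) / ((k + 1) z)` and leaves `-(-(k + 1) z)^j H((k + 1) z)`. The constant
coefficient, where no such cancellation occurs, is removed by the subtraction. -/
theorem familyOp_sub_mem_regular (hu : AnalyticAt ℂ u 0) (hu0 : u 0 = 1) {a : ℂ → ℂ[X]} {p : K[X]}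
    (hap : (a, p) ∈ regular K u) {H : ℂ → ℂ} {c : ℕ → K}
    (hH : HasFPowerSeriesAt H (FormalMultilinearSeries.ofScalars ℂ fun n => algebraMap K ℂ (c n))
      0) :
    (familyOp K (fun w => H w / w) a - familyEval K u (familyOp K (fun w => H w / w) a),
      physOp c p) ∈ regular K u := by
  obtain ⟨N, hN⟩ := hap.1
  set b := familyOp K (fun w => H w / w) a with hb
  have hbN (z : ℂ) : (b z).natDegree ≤ N + 1 := natDegree_shiftOp_le _ _ (hN z)
  have hbmer (k : ℕ) : MeromorphicAt (fun z => (b z).coeff k) 0 := by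
    rcases k with _ | k
    · simp only [hb, familyOp_apply, coeff_shiftOp_zero]
      exact MeromorphicAt.const _ _
    · simp only [hb, familyOp_apply, coeff_shiftOp_succ]
      have h1 : AnalyticAt ℂ (fun z : ℂ => H (((k : ℂ) + 1) * z)) 0 := by
        refine AnalyticAt.fun_comp (f := fun z : ℂ => ((k : ℂ) + 1) * z) ?_ (by fun_prop)
        simpa using hH.analyticAt
      have h2 : MeromorphicAt (fun z : ℂ => ((k : ℂ) + 1) * z) 0 := by fun_prop
      exact (h1.meromorphicAt.div h2).mul (hap.2.1 k)
  refine ⟨⟨N + 1, fun z => ?_⟩, fun k => ?_, fun j => ?_⟩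
  · exact (Polynomial.natDegree_sub_C).le.trans (hbN z)
  · simp only [Pi.sub_apply, familyEval_apply, Polynomial.coeff_sub, Polynomial.coeff_C]
    refine (hbmer k).sub ?_
    split_ifs
    · exact meromorphicAt_eval hbN hbmer hu.meromorphicAt
    · exact MeromorphicAt.const _ _
  · have hC (z v : ℂ) : taylorHom (u z) z (Polynomial.C v) = PowerSeries.C v := by
      rw [taylorHom, Polynomial.aeval_C]
      rfl
    simp only [Pi.sub_apply, familyEval_apply, map_sub, hC]
    rcases j with _ | j
    -- The constant coefficient in `l` is the value at `q = u z`, exactly what is subtracted.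
    · rw [coeff_zero_physOp, map_zero]
      refine tendsto_const_nhds.congr fun z => ?_
      rw [coeff_taylorHom _ _ _ (hbN z),
        Polynomial.eval_eq_sum_range' (Nat.lt_succ_of_le (hbN z))]
      simp
    -- The Taylor exponents are `-(k * z)`, so `H` is expanded in `w = -(k * z)`; this is the origin
    -- of the signs `(-1)^n` in `physOp`.
    · have hH' : ∀ᶠ w : ℂ in 𝓝 0, HasSum (fun n => ((-1) ^ n * algebraMap K ℂ (c n)) * w ^ n)
          (H (-w)) := by
        have h1 := hasFPowerSeriesAt_iff.1 hH
        have h2 : Filter.Tendsto (fun w : ℂ => -w) (𝓝 0) (𝓝 0) := by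
          simpa using (continuous_neg (G := ℂ)).tendsto 0
        filter_upwards [h2.eventually h1] with w hw
        rw [zero_add] at hw
        refine hw.congr_fun fun n => ?_
        rw [FormalMultilinearSeries.coeff_ofScalars, neg_pow, smul_eq_mul]
        ring
      -- Multiplication by `X` aligns the coefficient `k` of `a` with the argument `(k + 1) z` of
      -- `H`.
      have hX := (regular K u).mul_mem (X_mem_regular hu hu0) hap
      rw [Prod.mk_mul_mk, one_mul] at hX
      have hXN (z : ℂ) : (((fun _ => Polynomial.X) * a : ℂ → ℂ[X]) z).natDegree ≤ N + 1 := by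
        rw [Pi.mul_apply, add_comm]
        exact Polynomial.natDegree_mul_le_of_le Polynomial.natDegree_X_le (hN z)
      have h := (tendsto_sum_of_mem_regular hu hX hH' j (Nat.lt_succ_self _) hXN).const_mul
        (-(((j + 1).factorial : ℂ)⁻¹))
      have hlim : algebraMap K ℂ ((physOp c p).coeff (j + 1)) = -(((j + 1).factorial : ℂ)⁻¹) *
          ∑ n ∈ Finset.range (p.natDegree + 1), (-1) ^ n * algebraMap K ℂ (c n) *
            ((n + j).factorial * algebraMap K ℂ (p.coeff (n + j))) := by
        rw [coeff_succ_physOp c p j _ (Nat.lt_succ_self _)]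
        simp
      rw [hlim]
      refine h.congr' ?_
      filter_upwards [self_mem_nhdsWithin] with z hz
      rw [PowerSeries.coeff_C, if_neg (Nat.succ_ne_zero j), sub_zero,
        coeff_taylorHom _ _ _ (hbN z), Finset.mul_sum]
      refine Finset.sum_congr rfl fun k _ => ?_
      rcases k with _ | k
      · simp [hb, familyOp_apply, coeff_shiftOp_zero]
      · have h1 : (k : ℂ) + 1 ≠ 0 := by exact_mod_cast Nat.succ_ne_zero k
        have h2 : z ≠ 0 := hz
        simp only [hb, familyOp_apply, coeff_shiftOp_succ, Pi.mul_apply, Polynomial.coeff_X_mul,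
          neg_neg, Nat.cast_add, Nat.cast_one]
        field_simp
        ring

end Regular

/-! ### Existence and uniqueness of the physical limit -/

section Limit

variable {K : Type*} [Field K] [Algebra K ℂ]

/-- Any continuation agrees with `g` on the half-plane, which accumulates at `0`, so both values are
the limit of `g` itself there. -/
theorem HasPhysicalLimit.unique {g : ℂ → ℂ} {v w : ℂ} (hv : HasPhysicalLimit g v)
    (hw : HasPhysicalLimit g w) : v = w := by
  obtain ⟨G, -, h1, h2⟩ := hv
  obtain ⟨G', -, h1', h2'⟩ := hw
  have h3 := (h2.mono_left halfPlane_le_punctured).congr' (h1.mono fun _ h => h.symm)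
  have h3' := (h2'.mono_left halfPlane_le_punctured).congr' (h1'.mono fun _ h => h.symm)
  exact tendsto_nhds_unique h3 h3'

theorem eq_of_aeval_ofReal_eq {p q : K[X]}
    (h : ∀ r : ℝ, Polynomial.aeval (r : ℂ) p = Polynomial.aeval (r : ℂ) q) : p = q := by
  refine Polynomial.map_injective _ (algebraMap K ℂ).injective ?_
  refine Polynomial.eq_of_infinite_eval_eq _ _ ?_
  refine (Set.infinite_range_of_injective Complex.ofReal_injective).mono ?_
  rintro _ ⟨r, rfl⟩
  simpa [Polynomial.aeval_def, Polynomial.eval_map] using h r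

theorem IsPhysicalLimit.unique {f : ℝ → ℂ} {μ : ℝ} (hμ : 0 < μ) {Ψ Φ : HR K → K[X]}
    (hΨ : IsPhysicalLimit K f μ Ψ) (hΦ : IsPhysicalLimit K f μ Φ) : Ψ = Φ := by
  ext1 x
  refine eq_of_aeval_ofReal_eq fun r => ?_
  -- At the scale `s = μ * exp r` the logarithm `ln (s / μ)` is the prescribed real number `r`.
  have hs : 0 < μ * Real.exp r := by positivity
  have h := (hΨ x _ hs).unique (hΦ x _ hs)
  rwa [mul_div_cancel_left₀ _ hμ.ne', Real.log_exp] at h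

theorem isPhysicalLimit_universalHom {f : ℝ → ℂ} {H : ℂ → ℂ} {c : ℕ → K}
    (hf : ∀ᶠ z : ℂ in 𝓝[{z | 0 < z.re}] 0,
      MeasureTheory.IntegrableOn (fun ζ : ℝ => f ζ * (ζ : ℂ) ^ (-z)) (Set.Ioi 0))
    (hH : HasFPowerSeriesAt H (FormalMultilinearSeries.ofScalars ℂ fun n => algebraMap K ℂ (c n))
      0)
    (hF : ∀ᶠ z : ℂ in 𝓝[{z | 0 < z.re}] 0,
      ∫ ζ in Set.Ioi (0 : ℝ), f ζ * (ζ : ℂ) ^ (-z) = H z / z)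
    {μ : ℝ} (hμ : 0 < μ) : IsPhysicalLimit K f μ (universalHom K (physOp c)) := by
  intro x s hs
  have hμ' : (μ : ℂ) ≠ 0 := Complex.ofReal_ne_zero.2 hμ.ne'
  have hs' : (s : ℂ) ≠ 0 := Complex.ofReal_ne_zero.2 hs.ne'
  have hpow {r : ℂ} (hr : r ≠ 0) : AnalyticAt ℂ (fun z : ℂ => r ^ (-z)) 0 := by
    simp only [Complex.cpow_def_of_ne_zero hr]
    fun_prop
  set u : ℂ → ℂ := fun z => (μ : ℂ) ^ (-z) with hu
  have hu0 : u 0 = 1 := by simp [hu]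
  set C := renormalize (familyEval K u) (universalHom K (familyOp K fun w => H w / w)) with hC
  have hreg : (C x, universalHom K (physOp c) x) ∈ regular K u := by
    refine mem_subalgebra_of_bPlus (C.prod (universalHom K (physOp c))) _ (fun t ht => ?_) x
    rw [AlgHom.prod_apply] at ht ⊢
    rw [universalHom_bPlus, hC, renormalize_bPlus (familyEval K u) _
      (familyOp K fun w => H w / w) (universalHom_bPlus K _) (familyEval_idem u)
      (familyOp_familyEval_mul _ u)]
    exact familyOp_sub_mem_regular (hpow hμ') hu0 ht hH
  obtain ⟨⟨N, hN⟩, hrep⟩ := toyRenormalized_representation hf hF hμ x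
  refine ⟨fun z => (C x z).eval ((s : ℂ) ^ (-z)),
    meromorphicAt_eval hN hreg.2.1 (hpow hs').meromorphicAt,
    hrep.mono fun z hz => hz s hs, ?_⟩
  -- Here `s^(-z) = μ^(-z) exp(-z ln(s/μ))`.
  refine (tendsto_eval_of_mem_regular (hpow hμ') hreg _).congr fun z => ?_
  congr 1
  rw [Complex.cpow_def_of_ne_zero hμ', Complex.cpow_def_of_ne_zero hs', ← Complex.exp_add,
    ← Complex.ofReal_log hμ.le, ← Complex.ofReal_log hs.le, Real.log_div hs.ne' hμ.ne']
  congr 1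
  push_cast
  ring

end Limit

/-! ### The kernel `1 / (1 + ζ)` -/

section OriginalKernel

open MeasureTheory Set

theorem integrableOn_kernel {z : ℂ} (h0 : 0 < z.re) (h1 : z.re < 1) :
    IntegrableOn (fun ζ : ℝ => 1 / ((ζ : ℂ) + 1) * (ζ : ℂ) ^ (-z)) (Ioi 0) := by
  have hne {ζ : ℝ} (hζ : 0 ≤ ζ) : (ζ : ℂ) + 1 ≠ 0 := by
    exact_mod_cast (by positivity : ζ + 1 ≠ 0)
  have hnorm {ζ : ℝ} (hζ : 0 ≤ ζ) : ‖1 / ((ζ : ℂ) + 1)‖ = 1 / (ζ + 1) := by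
    rw [norm_div, norm_one, ← Complex.ofReal_one, ← Complex.ofReal_add, Complex.norm_real,
      Real.norm_of_nonneg (by positivity)]
  have h : MellinConvergent (fun ζ : ℝ => 1 / ((ζ : ℂ) + 1)) (1 - z) := by
    -- The kernel is at most `1/ζ` at infinity and bounded by `1` at zero, so the Mellin transform
    -- converges for real parts of `1 - z` in `(0, 1)`.
    refine mellinConvergent_of_isBigO_rpow (a := 1) (b := 0) ?_ ?_ ?_ ?_ ?_
    · refine ContinuousOn.locallyIntegrableOn (fun ζ hζ => ContinuousAt.continuousWithinAt ?_)
        measurableSet_Ioi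
      have := hne (le_of_lt hζ)
      fun_prop (disch := assumption)
    · refine Asymptotics.IsBigO.of_bound 1 ?_
      filter_upwards [Filter.eventually_gt_atTop 0] with ζ hζ
      rw [hnorm hζ.le, one_mul, Real.rpow_neg_one, norm_inv, Real.norm_of_nonneg hζ.le, one_div]
      gcongr
      linarith
    · simpa using h0
    · refine Asymptotics.IsBigO.of_bound 1 ?_
      filter_upwards [self_mem_nhdsWithin] with ζ hζ
      have hζ : 0 < ζ := hζ
      rw [hnorm hζ.le, neg_zero, Real.rpow_zero, norm_one, one_mul]
      exact div_le_one_of_le₀ (by linarith) (by positivity)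
    · simpa using h1
  refine IntegrableOn.congr_fun h (fun ζ _ => ?_) measurableSet_Ioi
  simp only [smul_eq_mul]
  rw [show (1 - z - 1 : ℂ) = -z by ring, mul_comm]

theorem integrableOn_cpow_unit {w : ℂ} (hw : -1 < w.re) :
    IntegrableOn (fun t : ℝ => (t : ℂ) ^ w) (Ioc 0 1) :=
  (intervalIntegrable_iff_integrableOn_Ioc_of_le zero_le_one).1
    (intervalIntegral.intervalIntegrable_cpow' hw)

theorem integrableOn_cpow_div {w : ℂ} (hw : -1 < w.re) :
    IntegrableOn (fun t : ℝ => (t : ℂ) ^ w * (1 / ((t : ℂ) + 1))) (Ioc 0 1) := by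
  refine Integrable.mul_bdd (c := 1) (integrableOn_cpow_unit hw) ?_ ?_
  · exact Measurable.aestronglyMeasurable (by fun_prop)
  · refine (ae_restrict_mem measurableSet_Ioc).mono fun t ht => ?_
    have ht : 0 < t := ht.1
    rw [norm_div, norm_one, ← Complex.ofReal_one, ← Complex.ofReal_add, Complex.norm_real,
      Real.norm_of_nonneg (by positivity)]
    exact div_le_one_of_le₀ (by linarith) (by positivity)

theorem integral_cpow_unit {w : ℂ} (hw : 0 < w.re) :
    ∫ t in Ioc (0 : ℝ) 1, (t : ℂ) ^ (w - 1) = 1 / w := by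
  have hw0 : w ≠ 0 := by
    rintro rfl
    simp at hw
  rw [← intervalIntegral.integral_of_le zero_le_one, integral_cpow (by left; simpa using hw)]
  simp [hw0]

theorem integral_kernel_Ioi_one (z : ℂ) :
    ∫ ζ in Ioi (1 : ℝ), 1 / ((ζ : ℂ) + 1) * (ζ : ℂ) ^ (-z) =
      ∫ t in Ioc (0 : ℝ) 1, (t : ℂ) ^ (z - 1) * (1 / ((t : ℂ) + 1)) := by
  set g : ℝ → ℂ := (Ioi (1 : ℝ)).indicator fun ζ => 1 / ((ζ : ℂ) + 1) * (ζ : ℂ) ^ (-z) with hg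
  have h1 : ∫ ζ in Ioi (0 : ℝ), g ζ = ∫ ζ in Ioi (1 : ℝ), 1 / ((ζ : ℂ) + 1) * (ζ : ℂ) ^ (-z) := by
    rw [hg, setIntegral_indicator measurableSet_Ioi, inter_eq_right.2 (Ioi_subset_Ioi zero_le_one)]
  -- The inversion `x ↦ 1/x` carries `(0, 1)` to `(1, ∞)`; extension by zero allows it to be
  -- performed on all of `(0, ∞)`.
  have h2 := integral_comp_rpow_Ioi g (p := -1) (by norm_num)
  rw [← h1, ← h2, integral_Ioc_eq_integral_Ioo]
  have h3 : EqOn (fun x : ℝ => (|(-1 : ℝ)| * x ^ ((-1 : ℝ) - 1)) • g (x ^ (-1 : ℝ)))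
      ((Ioo (0 : ℝ) 1).indicator fun t : ℝ => (t : ℂ) ^ (z - 1) * (1 / ((t : ℂ) + 1)))
      (Ioi 0) := by
    intro x hx
    have hx : 0 < x := hx
    simp only [hg, Real.rpow_neg_one]
    by_cases hx1 : x < 1
    · have hx' : (x : ℂ) ≠ 0 := Complex.ofReal_ne_zero.2 hx.ne'
      have hx2 : (x : ℂ) + 1 ≠ 0 := by exact_mod_cast (by positivity : x + 1 ≠ 0)
      have harg : (x : ℂ).arg ≠ Real.pi := by
        rw [Complex.arg_ofReal_of_nonneg hx.le]
        exact Real.pi_pos.ne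
      have h4 : (((x⁻¹ : ℝ) : ℂ)) ^ (-z) = (x : ℂ) ^ z := by
        rw [Complex.ofReal_inv, Complex.inv_cpow _ _ harg, Complex.cpow_neg, inv_inv]
      have h5 : x ^ ((-1 : ℝ) - 1) = (x ^ 2)⁻¹ := by
        rw [show (-1 : ℝ) - 1 = -(2 : ℕ) by norm_num, Real.rpow_neg hx.le, Real.rpow_natCast]
      rw [indicator_of_mem (mem_Ioi.2 ((one_lt_inv₀ hx).2 hx1)),
        indicator_of_mem (mem_Ioo.2 ⟨hx, hx1⟩), h4, h5, Complex.cpow_sub _ _ hx', Complex.cpow_one, abs_neg, abs_one, one_mul,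
        Complex.real_smul]
      have hx3 : (1 : ℂ) + x ≠ 0 := by rwa [add_comm]
      push_cast
      field_simp
      ring
    · rw [indicator_of_notMem, indicator_of_notMem, smul_zero]
      · exact fun h => hx1 h.2
      · exact fun h => hx1 ((one_lt_inv₀ hx).1 h)
  rw [setIntegral_congr_fun measurableSet_Ioi h3, setIntegral_indicator measurableSet_Ioo,
    inter_eq_right.2 Ioo_subset_Ioi_self]

/-- After inverting the part over `(1, ∞)`, the identity `t^(z-1)/(t+1) = t^(z-1) - t^z/(t+1)`
isolates the pole, as `t^(z-1)` integrates to `1/z`. -/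
theorem integral_kernel {z : ℂ} (h0 : 0 < z.re) (h1 : z.re < 1) :
    ∫ ζ in Ioi (0 : ℝ), 1 / ((ζ : ℂ) + 1) * (ζ : ℂ) ^ (-z) =
      1 / z + ∫ t in Ioc (0 : ℝ) 1, ((t : ℂ) ^ (-z) - (t : ℂ) ^ z) * (1 / ((t : ℂ) + 1)) := by
  have hint := integrableOn_kernel h0 h1
  have hz1 : -1 < (-z).re := by
    rw [Complex.neg_re]
    linarith
  have hz2 : -1 < z.re := by linarith
  have h2 : ∫ t in Ioc (0 : ℝ) 1, (t : ℂ) ^ (z - 1) * (1 / ((t : ℂ) + 1)) =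
      1 / z - ∫ t in Ioc (0 : ℝ) 1, (t : ℂ) ^ z * (1 / ((t : ℂ) + 1)) := by
    rw [← integral_cpow_unit h0, ← integral_sub (integrableOn_cpow_unit (by simpa using h0))
      (integrableOn_cpow_div hz2)]
    refine setIntegral_congr_fun measurableSet_Ioc fun t ht => ?_
    have ht : 0 < t := ht.1
    have ht' : (t : ℂ) ≠ 0 := Complex.ofReal_ne_zero.2 ht.ne'
    have ht2 : (t : ℂ) + 1 ≠ 0 := by exact_mod_cast (by positivity : t + 1 ≠ 0)
    rw [Complex.cpow_sub _ _ ht', Complex.cpow_one]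
    field_simp
    ring
  rw [← Ioc_union_Ioi_eq_Ioi (zero_le_one' ℝ),
    setIntegral_union Ioc_disjoint_Ioi_same measurableSet_Ioi
      (hint.mono_set Ioc_subset_Ioi_self) (hint.mono_set (Ioi_subset_Ioi zero_le_one)),
    integral_kernel_Ioi_one, h2]
  simp only [sub_mul]
  rw [integral_sub (integrableOn_cpow_div hz1) (integrableOn_cpow_div hz2)]
  simp only [mul_comm (1 / _ : ℂ)]
  ring

/-- Expand `t^(±z) = exp(±z log t)` and integrate termwise. The partial sums are dominated by `2
exp(‖z‖ |log t|) = 2 t^(-‖z‖)`, integrable on `(0, 1]` for `‖z‖ < 1`. -/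
theorem hasSum_integral_kernel {z : ℂ} (hz : ‖z‖ < 1) :
    HasSum (fun n : ℕ => ((∫ t in Ioc (0 : ℝ) 1,
        ((-1) ^ n - 1) / n.factorial * Real.log t ^ n * (1 / (t + 1)) : ℝ) : ℂ) * z ^ n)
      (∫ t in Ioc (0 : ℝ) 1, ((t : ℂ) ^ (-z) - (t : ℂ) ^ z) * (1 / ((t : ℂ) + 1))) := by
  have h : HasSum (fun n : ℕ => ∫ t in Ioc (0 : ℝ) 1,
      ((((-1) ^ n - 1) / n.factorial * Real.log t ^ n * (1 / (t + 1)) : ℝ) : ℂ) * z ^ n)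
      (∫ t in Ioc (0 : ℝ) 1, ((t : ℂ) ^ (-z) - (t : ℂ) ^ z) * (1 / ((t : ℂ) + 1))) := by
    have hexp (t : ℝ) : HasSum (fun n : ℕ => 2 * ((‖z‖ * |Real.log t|) ^ n / n.factorial))
        (2 * Real.exp (‖z‖ * |Real.log t|)) := by
      have h := NormedSpace.expSeries_div_hasSum_exp (‖z‖ * |Real.log t|)
      rw [← Real.exp_eq_exp_ℝ] at h
      exact h.mul_left 2
    refine hasSum_integral_of_dominated_convergence
      (fun n t => 2 * ((‖z‖ * |Real.log t|) ^ n / n.factorial)) (fun n => ?_) (fun n => ?_) ?_ ?_ ?_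
    · exact Measurable.aestronglyMeasurable (by fun_prop)
    · refine (ae_restrict_mem measurableSet_Ioc).mono fun t ht => ?_
      have ht : 0 < t := ht.1
      have h1 : |((-1 : ℝ) ^ n - 1)| ≤ 2 := by
        rcases neg_one_pow_eq_or ℝ n with h | h <;> rw [h] <;> norm_num
      have h2 : |1 / (t + 1)| ≤ 1 := by
        rw [abs_of_pos (by positivity)]
        exact div_le_one_of_le₀ (by linarith) (by positivity)
      rw [norm_mul, Complex.norm_real, norm_pow, Real.norm_eq_abs, abs_mul, abs_mul, abs_div,
        abs_pow, Nat.abs_cast]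
      calc |(-1 : ℝ) ^ n - 1| / n.factorial * |Real.log t| ^ n * |1 / (t + 1)| * ‖z‖ ^ n
          ≤ 2 / n.factorial * |Real.log t| ^ n * 1 * ‖z‖ ^ n := by gcongr
        _ = 2 * ((‖z‖ * |Real.log t|) ^ n / n.factorial) := by
          rw [mul_pow]
          ring
    · exact .of_forall fun t => (hexp t).summable
    · simp only [fun t => (hexp t).tsum_eq]
      have h1 : IntegrableOn (fun t : ℝ => 2 * t ^ (-‖z‖)) (Ioc 0 1) := by
        refine Integrable.const_mul ?_ _
        exact (intervalIntegrable_iff_integrableOn_Ioc_of_le zero_le_one).1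
          (intervalIntegral.intervalIntegrable_rpow' (by linarith))
      refine h1.congr_fun (fun t ht => ?_) measurableSet_Ioc
      simp only
      rw [Real.rpow_def_of_pos ht.1, abs_of_nonpos (Real.log_nonpos ht.1.le ht.2)]
      congr 2
      ring
    · refine (ae_restrict_mem measurableSet_Ioc).mono fun t ht => ?_
      have ht : 0 < t := ht.1
      have ht' : (t : ℂ) ≠ 0 := Complex.ofReal_ne_zero.2 ht.ne'
      have h1 (w : ℂ) : HasSum (fun n : ℕ => (Real.log t * w) ^ n / (n.factorial : ℂ))
          ((t : ℂ) ^ w) := by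
        have h := NormedSpace.expSeries_div_hasSum_exp ((Real.log t : ℂ) * w)
        rwa [← Complex.exp_eq_exp_ℂ, Complex.ofReal_log ht.le,
          ← Complex.cpow_def_of_ne_zero ht', ← Complex.ofReal_log ht.le] at h
      refine (((h1 (-z)).sub (h1 z)).mul_right (1 / ((t : ℂ) + 1))).congr_fun fun n => ?_
      push_cast
      rw [mul_neg, neg_pow, mul_pow]
      ring
  refine h.congr_fun fun n => ?_
  rw [integral_mul_const]
  exact congrArg (· * z ^ n) integral_ofReal.symm

theorem isToyKernel_one_div_add_one : IsToyKernel ℝ (fun ζ : ℝ => 1 / ((ζ : ℂ) + 1)) := by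
  -- Index `0` is the residue `1`; the coefficient of `z^n` sits at index `n + 1` and is real as the
  -- integral of a real function.
  refine ⟨?_, fun n => n.casesOn 1 fun n => ∫ t in Ioc (0 : ℝ) 1,
        ((-1) ^ n - 1) / n.factorial * Real.log t ^ n * (1 / (t + 1)), ?_⟩
  · filter_upwards [Ioo_mem_nhdsGT (zero_lt_one' ℝ)] with σ hσ
    exact integrableOn_kernel (by simpa using hσ.1) (by simpa using hσ.2)
  · have h : ∀ᶠ z : ℂ in 𝓝 0, ‖z‖ < 1 :=
      continuous_norm.continuousAt.eventually_lt_const (by simp)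
    filter_upwards [self_mem_nhdsWithin, nhdsWithin_le_nhds h] with z hz0 hz1
    rw [integral_kernel hz0 ((Complex.re_le_norm z).trans_lt hz1), add_comm]
    have h1 := (hasSum_nat_add_iff (f := fun n : ℕ => algebraMap ℝ ℂ
      (n.casesOn 1 fun n => ∫ t in Ioc (0 : ℝ) 1,
        ((-1) ^ n - 1) / n.factorial * Real.log t ^ n * (1 / (t + 1))) * z ^ ((n : ℤ) - 1)) 1
      (g := ∫ t in Ioc (0 : ℝ) 1, ((t : ℂ) ^ (-z) - (t : ℂ) ^ z) * (1 / ((t : ℂ) + 1)))).1 (by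
        refine (hasSum_integral_kernel hz1).congr_fun fun n => ?_
        rw [Nat.cast_add, Nat.cast_one, add_sub_cancel_right, zpow_natCast]
        rfl)
    simpa using h1

end OriginalKernel

end ToyModel

/-! ### The main theorem -/

theorem mainTheorem3 (K : Type*) [Field K] [Algebra K ℂ] :
    (∀ f : ℝ → ℂ, ToyModel.IsToyKernel K f →
      (∀ x : ToyModel.HR K, ∀ᶠ z : ℂ in 𝓝[{z | 0 < z.re}] 0, ∀ s : ℝ, 0 < s →
        MeasureTheory.IntegrableOn
          (fun ζ : ℝ => f ζ * ((s * ζ : ℝ) : ℂ) ^ (-z) * ToyModel.toyRule K f x z (s * ζ))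
          (Set.Ioi 0)) ∧
      ∃ Φ : ToyModel.HR K →ₐc[K] K[X],
        (∀ x, Φ (HopfAlgebra.antipode K x) = HopfAlgebra.antipode K (Φ x)) ∧
        ∀ μ : ℝ, 0 < μ →
          ToyModel.IsPhysicalLimit K f μ Φ ∧
          ∀ Ψ : ToyModel.HR K → K[X], ToyModel.IsPhysicalLimit K f μ Ψ → Ψ = Φ) ∧
    ToyModel.IsToyKernel ℝ (fun ζ : ℝ => 1 / ((ζ : ℂ) + 1)) := by
  refine ⟨?_, ToyModel.isToyKernel_one_div_add_one⟩
  rintro f ⟨hf, c, hc⟩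
  have : CharZero K := (RingHom.charZero_iff (algebraMap K ℂ).injective).2 inferInstance
  have hf' := ToyModel.eventually_integrableOn_kernel hf
  obtain ⟨H, hH, hF⟩ := ToyModel.exists_hasFPowerSeriesAt hc
  -- Every `φ(x)` is represented by a family of polynomials, so the integral of the toy operator
  -- converges on it. The witness `physHom c` is chosen before `μ`.
  refine ⟨fun x => (ToyModel.toyOp_representation hf' hF
    (ToyModel.toyRule_representation (K := K) hf' hF x)).1, ToyModel.physHom c,
    ToyModel.bialgHom_antipode _, fun μ hμ => ?_⟩
  have h : ToyModel.IsPhysicalLimit K f μ (ToyModel.physHom c) :=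
    ToyModel.isPhysicalLimit_universalHom hf' hH hF hμ
  exact ⟨h, fun Ψ hΨ => hΨ.unique hμ h⟩
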